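/- **Polynomials and systems.** Signals are functions $y:\mathbb Z\to\mathbb R$ with $y(t)=0$ for $t<0$. A $\delta\epsilon$-polynomial is a real polynomial in the commuting variables $\delta_i,\epsilon_j$ ($i,j\in\mathbb N$); it acts on pairs of signals, $F[y,u](t)$ being obtained by putting $\delta_i=y(t-i)$, $\epsilon_j=u(t-j)$. The star-product $F*[P,P']$ is the substitution $\delta_i\mapsto P$ with all delays increased by $i$, $\epsilon_j\mapsto P'$ with all delays increased by $j$. A linear $\delta$- (or $\epsilon$-) polynomial is $\sum_i a_i\delta_i$ (or $\sum_i a_i\epsilon_i$). Linear polynomials are identified with $\sum_i a_iX^i\in\mathbb R[X]$, so that $*$ becomes multiplication, the units are the $c\,\delta_0$ with $c\ne0$, and divisibility, gcd and $\deg$ have their usual meaning. Every $P$ without constant term is the sum of its pure $\delta$-part $P_\delta$, its pure $\epsilon$-part $P_\epsilon$ and its $\delta\epsilon$-part $P_{\delta\epsilon}$. A multi-index is an ascending vector of delays; $\mathbf i<\mathbf i'$ if $\mathbf i$ has smaller dimension, or the dimensions agree and the right-most nonzero entry of $\mathbf i'-\mathbf i$ is positive. Terms $\delta_{\mathbf i}\epsilon_{\mathbf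 j}$ are ordered first by $\mathbf i$, then by $\mathbf j$. A zero term is one whose $\delta$-part, if not empty, contains $\delta_0$ and whose $\epsilon$-part, if not empty, contains $\epsilon_0$. **FLF-Algorithm.** Work over the polynomial ring over $\mathbb R$ in the parameters $w_{\lambda,u,h,k},s_{\lambda,\omega,h,k}$. *Subroutine* REM$(u,\omega,h)$ on $P$: if the linear part of $P$ is not zero, record it, with companion coefficient $1$, as the factor $L_{0,u,h}$ if $u\neq0$ and as $M_{0,\omega,h}$ if $u=0$, and subtract it from $P$. Then, for $\lambda=1,2,\dots$, as long as there are non-zero terms (terms that are not zero terms): let $c\,\delta_{i_1}\cdots\delta_{i_n}\epsilon_{j_1}\cdots\epsilon_{j_m}$ (delays ascending) be the maximum non-zero term, put $L_{\lambda,u,h}=\sum_{k<i_1}w_{\lambda,u,h,k}\delta_k+\delta_{i_1}$ and $M_{\lambda,\omega,h}=\sum_{k<j_1}s_{\lambda,\omega,h,k}\epsilon_k+\epsilon_{j_1}$, subtract $c\,\delta_0\delta_{i_2-i_1}\cdots\delta_{i_n-i_1}\epsilon_0\epsilon_{j_2-j_1}\cdots\epsilon_{j_m-j_1}*[L_{\lambda,u,h},M_{\lambda,\omega,h}]$,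 and record $L_{\lambda,u,h}$ (if $n\ge1$) and $M_{\lambda,\omega,h}$ (if $m\ge1$), both with companion coefficient $c$. The output is what is left. *Factoring out*: from $R$ to $\tilde R$, where $R=\delta_0^{\kappa}\epsilon_0^{\sigma}\tilde R$, $\tilde R$ has no constant term and $(\kappa,\sigma)$ is maximal with this property (any maximal pair is allowed; $\tilde R=0$ if $R=0$). *Main loop*, started with $h=0$ and $P=F$: (1) for $u=1,2,\dots$ (with $\omega=0$) replace $P_\delta$ by the result of REM$(u,0,h)$ followed by factoring out, until it is $0$ or a polynomial in $\delta_0$ only; the result is the remainder $R_{\delta,h}$. (2) The same with $P_\epsilon$, $u=0$, $\omega=1,2,\dots$, until it is $0$ or a polynomial in $\epsilon_0$ only; the result is $R_{\epsilon,h}$. (3) If $P_{\delta\epsilon}$ is $0$ or a polynomial in $\delta_0,\epsilon_0$ only, put $R_{\delta\epsilon}=P_{\delta\epsilon}$ and end. Otherwise apply REM$(0,0,h)$ to $P_{\delta\epsilon}$, factor out, and repeat with the result as new $P$ and with $h+1$. Let $\mathcal L,\mathcal M$ be the families of recorded $L_{\lambda,u,h}$ and $M_{\lambda,\omega,h}$;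 $\overline{\mathcal L},\overline{\mathcal M}$ the subfamilies with $u\ne0$, respectively $\omega\neq 0$; $\mathcal L_\delta$ that of the $L_{\lambda,u,0}$ with $u\ne0$; a star $^*$ removes $L_{0,1,0}$, respectively $M_{0,1,0}$ (the linear parts of $F$). **MM-Algorithm.** A rule is an assignment of real values to all parameters. For a family $\mathcal F$ of factors let $GCDV(\mathcal F)$ be the set of rules for which the set of members of $\mathcal F$ with nonzero companion coefficient is nonempty and its evaluated members have a common divisor that is not a unit. Put $LV=GCDV(\mathcal L_\delta)$, $GV=GCDV(\mathcal L\cup\overline{\mathcal M})\cup GCDV(\overline{\mathcal L}\cup\mathcal M)$, $MV=GCDV(\mathcal L^*\cup\overline{\mathcal M}^*)\cup GCDV(\overline{\mathcal L}^*\cup\mathcal M^*)$; let $DR$ be the set of rules with $R_{\delta,0}=0$ and $RV$ the set of rules that annihilate all $R_{\delta,h},R_{\epsilon,h}$ and $R_{\delta\epsilon}$. Call $\Phi\in\mathbb R[X]$ a common factor of $\mathcal F$ over a rule if it divides every evaluated member of $\mathcal F$ with nonzero companion coefficient. Then $\mathbf F_1$ is the set of the common factors of $\mathcal L_\delta$ over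 some rule in $LV\cap DR$; $\mathbf F_2$ that of the common factors of $\mathcal L\cup\overline{\mathcal M}$ or of $\overline{\mathcal L}\cup\mathcal M$ over some rule in $RV\cap GV$; $\mathbf F_3$ that of the common factors of $\mathcal L^*\cup\overline{\mathcal M}^*$ or of $\overline{\mathcal L}^*\cup\mathcal M^*$ over some rule in $RV\cap MV$. **Matching.** For a feedback law $u=Sy$, $S$ a linear $\delta$-polynomial, let $k_S$ be the maximum delay in the closed-loop polynomial $F*[\delta_0,S]$. An output of the closed loop is a signal $y$ with $F[y,Sy](t)=0$ for all $t\ge k_S$. A desired output is a signal $y^*$ with $A_dy^*(t)=0$ for all $t\ge\deg A_d$. Put $k=\max(k_S,\deg A_d)$, the number of common initial conditions. The closed loop is solvable if, for $t\ge k_S$, its equation at time $t$ and the values before $t$ admit at most one value $y(t)$. We say that $S$ gives matching for $y^*$ if $y^*$ is an output of the closed loop and, whenever the closed loop is solvable, every output $y$ of the closed loop with $y(t)=y^*(t)$ for $t<k$ is equal to $y^*$. **Theorem.** Let $F$ be a $\delta\epsilon$-polynomial without constant term, with linear $\delta$-part $A$ and linear $\epsilon$-part $-B$ (as polynomials in $\mathbb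 R[X]$), let $A_d$ be a linear $\delta$-polynomial, and let $\mathbf F_1,\mathbf F_2,\mathbf F_3$ be the sets returned by the MM-Algorithm for $F$. Let $Q$ be an arbitrary linear $\delta$-polynomial. (a) The law $u=Sy$ gives matching for every desired output $y^*$, where $S=Q*A_d$ if $A_d\in\mathbf F_1$; $S=Q$ if $A_d\in\mathbf F_2$; $S=Z_0+Q*A_d$ if $A_d\in\mathbf F_3$ and $(R_0,Z_0)$ is any solution of $R*A_d+Z*B=A$. (b) Suppose that the coefficient of $\delta_0$ in $A_d$ is not zero, and let $\tilde\Phi$ be a gcd of $A_d$ and $\Phi$ that is not a unit. Let $S=Q*\tilde\Phi$ if $\Phi\in\mathbf F_1$; $S=Q$ if $\Phi\in\mathbf F_2$; $S=Z_0+Q*\tilde\Phi$ if $\Phi\in\mathbf F_3$ and $(R_0,Z_0)$ is any solution of $R*\tilde\Phi+Z*B=A$. Then $u=Sy$ gives matching for every desired output $y^*$ whose initial conditions satisfy $\tilde\Phi y_0=0$, in the sense that $\tilde\Phi y^*(t)=0$ at the last $\nu=\deg A_d-\deg\tilde\Phi$ instants $t=k-\nu,\dots,k-1$ of the initial segment (for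 $\nu=1$ this is the single equation $\sum_i\tau_iy_{k-1-i}=0$, $\tilde\Phi=\sum_i\tau_i\delta_i$). -/

import Mathlib

open scoped Polynomial

namespace ModelMatching

/-! ### Signals, `δε`-polynomials, linear polynomials, the star-product -/

/-- A signal is causal if it vanishes at negative times. -/
def Causal (y : ℤ → ℝ) : Prop := ∀ t, t < 0 → y t = 0

/-- A `δε`-polynomial. The variable `Sum.inl i` is the operator `δ_i` (delay `i` of the output),
the variable `Sum.inr j` is `ε_j` (delay `j` of the input). Sum and dot-product of
`δε`-polynomials are the ring operations. -/
abbrev DEPoly (R : Type*) [CommSemiring R] := MvPolynomial (ℕ ⊕ ℕ) R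

/-- The sequence `A[y(t), u(t)]`. -/
noncomputable def act (A : DEPoly ℝ) (y u : ℤ → ℝ) : ℤ → ℝ := fun t =>
  MvPolynomial.eval (Sum.elim (fun i : ℕ => y (t - i)) (fun j : ℕ => u (t - j))) A

/-- All delays of `A` increased by `i`. -/
noncomputable def shift {R : Type*} [CommSemiring R] (i : ℕ) (A : DEPoly R) : DEPoly R :=
  MvPolynomial.rename (Sum.map (fun k => k + i) (fun k => k + i)) A

/-- The star-product `A * [B, C]`: substitution of `B` for the output and `C` for the input. -/
noncomputable def starProd {R : Type*} [CommSemiring R] (A B C : DEPoly R) : DEPoly R :=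
  MvPolynomial.bind₁ (Sum.elim (fun i => shift i B) (fun j => shift j C)) A

/-- The star-product is the composition of the associated maps on signals. -/
theorem act_starProd (A B C : DEPoly ℝ) (w v : ℤ → ℝ) :
    act (starProd A B C) w v = act A (act B w v) (act C w v) := by
  funext t
  simp only [act, starProd, MvPolynomial.eval, MvPolynomial.eval₂Hom_bind₁]
  congr 2
  funext x
  rcases x with i | j <;>
  · simp only [Sum.elim_inl, Sum.elim_inr, shift, MvPolynomial.coe_eval₂Hom,
      MvPolynomial.eval₂_rename]
    congr 1
    funext z
    rcases z with k | k <;> simp [sub_sub, add_comm]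

/-- A linear polynomial `∑ aᵢ δᵢ` is coded by the polynomial `∑ aᵢ Xⁱ`; the star-product of linear
polynomials is then the product of `R[X]` and `δ_0` is `1`. This is the `δ`-polynomial. -/
noncomputable def linOut {R : Type*} [CommSemiring R] (p : R[X]) : DEPoly R :=
  p.sum fun i a => MvPolynomial.C a * MvPolynomial.X (Sum.inl i)

/-- The linear `ε`-polynomial `∑ aᵢ εᵢ` with code `∑ aᵢ Xⁱ`. -/
noncomputable def linIn {R : Type*} [CommSemiring R] (p : R[X]) : DEPoly R :=
  p.sum fun i a => MvPolynomial.C a * MvPolynomial.X (Sum.inr i)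

/-- The sequence `S y(t) = ∑ aᵢ y(t - i)`, for a linear polynomial `S = ∑ aᵢ δᵢ`. -/
noncomputable def linAct (S : ℝ[X]) (y : ℤ → ℝ) : ℤ → ℝ := fun t =>
  S.sum fun i a => a * y (t - i)

/-- The linear `δ`-part of `A`, as a code. -/
noncomputable def outLinPart {R : Type*} [CommSemiring R] (A : DEPoly R) : R[X] :=
  MvPolynomial.aeval (Sum.elim (fun i : ℕ => (Polynomial.X ^ i : R[X])) (fun _ : ℕ => 0))
    (MvPolynomial.homogeneousComponent 1 A)

/-- The linear `ε`-part of `A`, as a code. -/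
noncomputable def inLinPart {R : Type*} [CommSemiring R] (A : DEPoly R) : R[X] :=
  MvPolynomial.aeval (Sum.elim (fun _ : ℕ => 0) (fun j : ℕ => (Polynomial.X ^ j : R[X])))
    (MvPolynomial.homogeneousComponent 1 A)

/-- The pure `δ`-part of `A` (the terms without `ε`). -/
noncomputable def outPart {R : Type*} [CommSemiring R] (A : DEPoly R) : DEPoly R :=
  MvPolynomial.bind₁ (Sum.elim (fun i => MvPolynomial.X (Sum.inl i)) (fun _ => 0)) A

/-- The pure `ε`-part of `A` (the terms without `δ`). -/
noncomputable def inPart {R : Type*} [CommSemiring R] (A : DEPoly R) : DEPoly R :=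
  MvPolynomial.bind₁ (Sum.elim (fun _ => 0) (fun j => MvPolynomial.X (Sum.inr j))) A

/-- The pure `δε`-part of `A`. -/
noncomputable def crossPart {R : Type*} [CommRing R] (A : DEPoly R) : DEPoly R :=
  A - outPart A - inPart A

/-! ### Order of terms -/

/-- A term `δ_𝐢 ε_𝐣`, given by its exponents. -/
abbrev Term := (ℕ ⊕ ℕ) →₀ ℕ

/-- The multi-index `𝐢` of the term, as the multiplicities of the delays. -/
noncomputable def outIdx (m : Term) : ℕ →₀ ℕ := m.comapDomain Sum.inl Sum.inl_injective.injOn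

/-- The multi-index `𝐣` of the term, as the multiplicities of the delays. -/
noncomputable def inIdx (m : Term) : ℕ →₀ ℕ := m.comapDomain Sum.inr Sum.inr_injective.injOn

/-- The order of multi-indices: first the dimension, then the right-most differing entry of the
ascendingly sorted vectors; in multiplicities, the largest delay whose multiplicities differ. -/
def IdxLT (a b : ℕ →₀ ℕ) : Prop :=
  a.degree < b.degree ∨
    (a.degree = b.degree ∧ ∃ d, a d < b d ∧ ∀ e, d < e → a e = b e)

/-- The order of `δε`-terms. -/
def TermLT (m m' : Term) : Prop :=
  IdxLT (outIdx m) (outIdx m') ∨ (outIdx m = outIdx m' ∧ IdxLT (inIdx m) (inIdx m'))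

/-- Zero terms: the lowest delay is zero in each of the (nonempty) `δ`- and `ε`-parts. -/
def IsZeroTerm (m : Term) : Prop :=
  (outIdx m ≠ 0 → outIdx m 0 ≠ 0) ∧ (inIdx m ≠ 0 → inIdx m 0 ≠ 0)

/-- `m` is the maximum non-zero term of `R`. -/
def IsMaxTerm {R : Type*} [CommSemiring R] (P : DEPoly R) (m : Term) : Prop :=
  m ∈ P.support ∧ ¬ IsZeroTerm m ∧
    ∀ m' ∈ P.support, ¬ IsZeroTerm m' → m' = m ∨ TermLT m' m

/-- The least delay in a multi-index. -/
noncomputable def minDelay (a : ℕ →₀ ℕ) : ℕ := sInf {i | a i ≠ 0}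

/-- From `δ_{i₁} ⋯ δ_{iₙ} ε_{j₁} ⋯ ε_{jₘ}` to
`δ_0 δ_{i₂-i₁} ⋯ δ_{iₙ-i₁} ε_0 ε_{j₂-j₁} ⋯ ε_{jₘ-j₁}`. -/
noncomputable def reduceTerm (m : Term) : Term :=
  m.mapDomain (Sum.map (fun i => i - minDelay (outIdx m)) (fun j => j - minDelay (inIdx m)))

/-! ### The formal linear factors algorithm

The algorithm is given by its runs. The only freedom in a run is the choice of the pair of
exponents in `FactorOut`. -/

/-- The parameters `w_{λ,u,h,k}` and `s_{λ,ω,h,k}`. -/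
inductive Param : Type
  | w (lam u h k : ℕ) : Param
  | s (lam om h k : ℕ) : Param

/-- Coefficients: real polynomials in the parameters. -/
abbrev Coef : Type := MvPolynomial Param ℝ

/-- A formal linear factor `L_{λ,u,h}` or `M_{λ,ω,h}` (`idx` is `u` or `ω`), with its companion
coefficient `cc`. -/
structure Factor where
  lam : ℕ
  idx : ℕ
  h : ℕ
  poly : Coef[X]
  cc : Coef

/-- `w_{λ,u,h,0} δ_0 + ⋯ + w_{λ,u,h,i-1} δ_{i-1} + δ_i`. -/
noncomputable def formalL (lam u h i : ℕ) : Coef[X] :=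
  ∑ k ∈ Finset.range i, Polynomial.C (MvPolynomial.X (Param.w lam u h k)) * Polynomial.X ^ k
    + Polynomial.X ^ i

/-- `s_{λ,ω,h,0} ε_0 + ⋯ + s_{λ,ω,h,j-1} ε_{j-1} + ε_j`. -/
noncomputable def formalM (lam om h j : ℕ) : Coef[X] :=
  ∑ k ∈ Finset.range j, Polynomial.C (MvPolynomial.X (Param.s lam om h k)) * Polynomial.X ^ k
    + Polynomial.X ^ j

/-- The loop of the subroutine REMAINDER, with counters `u`, `om`, `h`. `RemLoop u om h l P L M R`:
started with counter `λ = l` and polynomial `P`, the loop adds the factors `L`, `M` and ends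
with `R`. If the maximum term has no `δ` (no `ε`), the factor `L` is the null operator: it
does not enter the star-product and is not recorded (and likewise `M`). -/
inductive RemLoop (u om h : ℕ) :
    ℕ → DEPoly Coef → Set Factor → Set Factor → DEPoly Coef → Prop
  | done {l : ℕ} {P : DEPoly Coef} (hP : ∀ m ∈ P.support, IsZeroTerm m) :
      RemLoop u om h l P ∅ ∅ P
  | step {l : ℕ} {P R : DEPoly Coef} {L M : Set Factor} {m : Term} {p q : Coef[X]}
      (hm : IsMaxTerm P m)
      (hp : p = formalL (l + 1) u h (minDelay (outIdx m)))
      (hq : q = formalM (l + 1) om h (minDelay (inIdx m)))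
      (hrec : RemLoop u om h (l + 1)
        (P - MvPolynomial.C (P.coeff m) *
          starProd (MvPolynomial.monomial (reduceTerm m) 1) (linOut p) (linIn q)) L M R) :
      RemLoop u om h l P
        ({J | outIdx m ≠ 0 ∧ J = ⟨l + 1, u, h, p, P.coeff m⟩} ∪ L)
        ({J | inIdx m ≠ 0 ∧ J = ⟨l + 1, om, h, q, P.coeff m⟩} ∪ M) R

/-- The subroutine REMAINDER: input `A` and counters, new factors `L`, `M`, output `R`. The linear
part of `A`, if not zero, is recorded first, with `λ = 0` and companion coefficient `1`. -/
def Remainder (u om h : ℕ) (A : DEPoly Coef) (L M : Set Factor) (R : DEPoly Coef) : Prop :=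
  ∃ L' M' : Set Factor,
    RemLoop u om h 0 (A - MvPolynomial.homogeneousComponent 1 A) L' M' R ∧
    L = {J | MvPolynomial.homogeneousComponent 1 A ≠ 0 ∧ u ≠ 0 ∧
          J = ⟨0, u, h, outLinPart A, 1⟩} ∪ L' ∧
    M = {J | MvPolynomial.homogeneousComponent 1 A ≠ 0 ∧ u = 0 ∧
          J = ⟨0, om, h, inLinPart A, 1⟩} ∪ M'

/-- `R = δ_0^κ ε_0^σ · A'` with `A'` without constant term and `(κ, σ)` maximal (for `R = 0` the
result is `A' = 0`). -/
def FactorOut (R A' : DEPoly Coef) : Prop :=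
  ∃ κ σ : ℕ,
    R = MvPolynomial.X (Sum.inl 0) ^ κ * MvPolynomial.X (Sum.inr 0) ^ σ * A' ∧
    A'.coeff 0 = 0 ∧
    (R = 0 ∨ ∀ (κ' σ' : ℕ) (A'' : DEPoly Coef),
      R = MvPolynomial.X (Sum.inl 0) ^ κ' * MvPolynomial.X (Sum.inr 0) ^ σ' * A'' →
      A''.coeff 0 = 0 → κ ≤ κ' → σ ≤ σ' → κ' = κ ∧ σ' = σ)

/-- `A` is zero or a polynomial of `δ_0`, `ε_0` only. -/
def OnlyZeroDelay (A : DEPoly Coef) : Prop :=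
  ∀ v ∈ A.vars, v = Sum.inl 0 ∨ v = Sum.inr 0

/-- The REPEAT-UNTIL loops on the pure `δ`-part (`isOut = true`, the counter `n` is `u`, and
`ω = 0`) and on the pure `ε`-part (`isOut = false`, the counter `n` is `ω`, and `u = 0`).
The last polynomial is the remainder `R_{δ,h}` or `R_{ε,h}`. -/
inductive PureLoop (isOut : Bool) (h : ℕ) :
    ℕ → DEPoly Coef → Set Factor → Set Factor → DEPoly Coef → Prop
  | last {n : ℕ} {A R A' : DEPoly Coef} {L M : Set Factor}
      (hrem : Remainder (cond isOut n 0) (cond isOut 0 n) h A L M R)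
      (hfac : FactorOut R A') (hA' : OnlyZeroDelay A') :
      PureLoop isOut h n A L M A'
  | again {n : ℕ} {A R A' R' : DEPoly Coef} {L M L' M' : Set Factor}
      (hrem : Remainder (cond isOut n 0) (cond isOut 0 n) h A L M R)
      (hfac : FactorOut R A') (hA' : ¬ OnlyZeroDelay A')
      (hrec : PureLoop isOut h (n + 1) A' L' M' R') :
      PureLoop isOut h n A (L ∪ L') (M ∪ M') R'

/-- Output: the formal `δ`- and `ε`-linear factors (with their labels and companion
coefficients), the remainders `R_{δ,h}` and `R_{ε,h}` for `h = 0, …, h*` as pairs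
`(h, remainder)`, and `R_{δε}`. -/
structure FLFOutput where
  L : Set Factor
  M : Set Factor
  remOut : Set (ℕ × DEPoly Coef)
  remIn : Set (ℕ × DEPoly Coef)
  remCross : DEPoly Coef

/-- The main loop of the algorithm, entered with counter `h` and polynomial `A`. -/
inductive FLFLoop : ℕ → DEPoly Coef → FLFOutput → Prop
  | last {h : ℕ} {A Rd Re : DEPoly Coef} {L₁ M₁ L₂ M₂ : Set Factor}
      (hd : PureLoop true h 1 (outPart A) L₁ M₁ Rd)
      (he : PureLoop false h 1 (inPart A) L₂ M₂ Re)
      (hc : OnlyZeroDelay (crossPart A)) :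
      FLFLoop h A ⟨L₁ ∪ L₂, M₁ ∪ M₂, {(h, Rd)}, {(h, Re)}, crossPart A⟩
  | next {h : ℕ} {A Rd Re R A' : DEPoly Coef} {L₁ M₁ L₂ M₂ L₃ M₃ : Set Factor}
      {out : FLFOutput}
      (hd : PureLoop true h 1 (outPart A) L₁ M₁ Rd)
      (he : PureLoop false h 1 (inPart A) L₂ M₂ Re)
      (hc : ¬ OnlyZeroDelay (crossPart A))
      (hrem : Remainder 0 0 h (crossPart A) L₃ M₃ R)
      (hfac : FactorOut R A')
      (hrec : FLFLoop (h + 1) A' out) :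
      FLFLoop h A ⟨L₁ ∪ L₂ ∪ L₃ ∪ out.L, M₁ ∪ M₂ ∪ M₃ ∪ out.M,
        insert (h, Rd) out.remOut, insert (h, Re) out.remIn, out.remCross⟩

/-- `out` is an output of the formal linear factors algorithm applied to `F`. -/
def FLF (F : DEPoly ℝ) (out : FLFOutput) : Prop :=
  FLFLoop 0 (MvPolynomial.map MvPolynomial.C F) out

/-! ### Rules, the GCD-values algorithm, the MM-algorithm -/

/-- A rule: real values for all the parameters. -/
abbrev Rule : Type := Param → ℝ

/-- The factor evaluated over a rule. -/
noncomputable def Factor.evalAt (J : Factor) (ρ : Rule) : ℝ[X] :=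
  J.poly.map (MvPolynomial.eval ρ)

/-- The companion coefficient evaluated over a rule. -/
noncomputable def Factor.ccAt (J : Factor) (ρ : Rule) : ℝ := MvPolynomial.eval ρ J.cc

/-- The set of rules `GCDV(𝓕)`: for some nonempty `𝓐 ⊆ 𝓕` the companion coefficients are nonzero
on `𝓐` and zero on `𝓕 - 𝓐`, and the evaluated elements of `𝓐` have a nontrivial gcd (a common
divisor that is not a unit). -/
def GCDV (𝓕 : Set Factor) : Set Rule :=
  {ρ | ∃ 𝓐 ⊆ 𝓕, 𝓐.Nonempty ∧ (∀ J ∈ 𝓐, J.ccAt ρ ≠ 0) ∧ (∀ J ∈ 𝓕 \ 𝓐, J.ccAt ρ = 0) ∧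
    ∃ D : ℝ[X], ¬ IsUnit D ∧ ∀ J ∈ 𝓐, D ∣ J.evalAt ρ}

/-- `Φ` is a common factor of the elements of `𝓕` evaluated over `ρ` (of those that are present
in the expansion over `ρ`, that is, have a nonzero companion coefficient). -/
def CommonFactor (𝓕 : Set Factor) (ρ : Rule) (Φ : ℝ[X]) : Prop :=
  ∀ J ∈ 𝓕, J.ccAt ρ ≠ 0 → Φ ∣ J.evalAt ρ

/-- The factors that do not participate in cross-products. -/
def noCross (𝓕 : Set Factor) : Set Factor := {J ∈ 𝓕 | J.idx ≠ 0}

/-- All factors but the linear part of the system, which has the label `(0, 1, 0)`. -/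
def starred (𝓕 : Set Factor) : Set Factor := {J ∈ 𝓕 | ¬ (J.lam = 0 ∧ J.idx = 1 ∧ J.h = 0)}

namespace FLFOutput

/-- The linear factors of the pure `δ`-part of the system. -/
def Ldelta (out : FLFOutput) : Set Factor := {J ∈ out.L | J.idx ≠ 0 ∧ J.h = 0}

def LV (out : FLFOutput) : Set Rule := GCDV out.Ldelta

def GV (out : FLFOutput) : Set Rule :=
  GCDV (out.L ∪ noCross out.M) ∪ GCDV (noCross out.L ∪ out.M)

def MV (out : FLFOutput) : Set Rule :=
  GCDV (starred out.L ∪ starred (noCross out.M)) ∪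
    GCDV (starred (noCross out.L) ∪ starred out.M)

/-- The rules with `R_{δ,0} = 0`. -/
def DR (out : FLFOutput) : Set Rule :=
  {ρ | ∀ R, (0, R) ∈ out.remOut → MvPolynomial.map (MvPolynomial.eval ρ) R = 0}

/-- The rules that make all the remainders zero. -/
def RV (out : FLFOutput) : Set Rule :=
  {ρ | (∀ x ∈ out.remOut, MvPolynomial.map (MvPolynomial.eval ρ) x.2 = 0) ∧
    (∀ x ∈ out.remIn, MvPolynomial.map (MvPolynomial.eval ρ) x.2 = 0) ∧
    MvPolynomial.map (MvPolynomial.eval ρ) out.remCross = 0}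

/-- The set `𝐅₁` returned by the MM-algorithm. -/
def F1 (out : FLFOutput) : Set ℝ[X] :=
  {Φ | ∃ ρ ∈ out.LV ∩ out.DR, CommonFactor out.Ldelta ρ Φ}

/-- The set `𝐅₂` returned by the MM-algorithm. -/
def F2 (out : FLFOutput) : Set ℝ[X] :=
  {Φ | ∃ ρ ∈ out.RV ∩ out.GV, CommonFactor (out.L ∪ noCross out.M) ρ Φ} ∪
    {Φ | ∃ ρ ∈ out.RV ∩ out.GV, CommonFactor (noCross out.L ∪ out.M) ρ Φ}

/-- The set `𝐅₃` returned by the MM-algorithm. -/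
def F3 (out : FLFOutput) : Set ℝ[X] :=
  {Φ | ∃ ρ ∈ out.RV ∩ out.MV,
      CommonFactor (starred out.L ∪ starred (noCross out.M)) ρ Φ} ∪
    {Φ | ∃ ρ ∈ out.RV ∩ out.MV,
      CommonFactor (starred (noCross out.L) ∪ starred out.M) ρ Φ}

end FLFOutput

/-! ### Closed loop and model matching -/

/-- The polynomial `F * [δ_0, S]` of the closed-loop system `F[y(t), S y(t)] = 0`. -/
noncomputable def closedLoop (F : DEPoly ℝ) (S : ℝ[X]) : DEPoly ℝ :=
  starProd F (MvPolynomial.X (Sum.inl 0)) (linOut S)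

/-- The maximum delay of the output signal in a polynomial. -/
noncomputable def maxOutDelay (G : DEPoly ℝ) : ℕ := G.vars.sup (Sum.elim id (fun _ => 0))

/-- `y` is an output of the closed-loop system with `k` initial conditions, `k` its maximum
delay. -/
def IsLoopOutput (F : DEPoly ℝ) (S : ℝ[X]) (y : ℤ → ℝ) : Prop :=
  Causal y ∧ ∀ t : ℤ, (maxOutDelay (closedLoop F S) : ℤ) ≤ t → act F y (linAct S y) t = 0

/-- `y` is an output of the linear system `Ad y(t) = 0` with `deg Ad` initial conditions. -/
def IsLinOutput (Ad : ℝ[X]) (y : ℤ → ℝ) : Prop :=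
  Causal y ∧ ∀ t : ℤ, (Ad.natDegree : ℤ) ≤ t → linAct Ad y t = 0

/-- The closed-loop system can be solved for the current output: the equation at time `t`
and the earlier values determine `y(t)`. -/
def LoopSolvable (F : DEPoly ℝ) (S : ℝ[X]) : Prop :=
  ∀ (y y' : ℤ → ℝ) (t : ℤ), Causal y → Causal y' →
    (maxOutDelay (closedLoop F S) : ℤ) ≤ t → (∀ s, s < t → y s = y' s) →
    act F y (linAct S y) t = 0 → act F y' (linAct S y') t = 0 → y t = y' t

/-- Length of the vector `(y_0, …, y_{k-1})` of common initial conditions. -/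
noncomputable def initLength (F : DEPoly ℝ) (S Ad : ℝ[X]) : ℕ :=
  max (maxOutDelay (closedLoop F S)) Ad.natDegree

/-- With the feedback `u = S y` the plant matches the desired system `Ad y* = 0` under identical
initial conditions that satisfy `I`: `y*` is an output of the closed loop, and, when the closed
loop is solvable, it is the only one with these initial conditions. -/
def MatchesOn (F : DEPoly ℝ) (S Ad : ℝ[X]) (I : (ℤ → ℝ) → Prop) : Prop :=
  ∀ ys : ℤ → ℝ, IsLinOutput Ad ys → I ys →
    IsLoopOutput F S ys ∧
    (LoopSolvable F S → ∀ y : ℤ → ℝ, IsLoopOutput F S y →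
      (∀ t : ℤ, t < (initLength F S Ad : ℤ) → y t = ys t) → y = ys)

/-- Matching under arbitrary identical initial conditions. -/
def Matches (F : DEPoly ℝ) (S Ad : ℝ[X]) : Prop := MatchesOn F S Ad fun _ => True

/-- The initial conditions `(y_0, …, y_{k-1})` satisfy `K y = 0` at the last `n` instants
`k - n, …, k - 1`. For `n = 1` this is the single equation `∑ τᵢ y_{k-1-i} = 0`. -/
def InitRel (K : ℝ[X]) (n k : ℕ) (y : ℤ → ℝ) : Prop :=
  ∀ t : ℤ, (k : ℤ) - n ≤ t → t < k → linAct K y t = 0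

/-- Matching under identical initial conditions that satisfy `K y_0 = 0`, `K` a factor of `Ad`.
The sequence `K y*` solves a linear system of order `deg Ad - deg K`; its vanishing is the
matter of that many instants. -/
def MatchesRel (F : DEPoly ℝ) (S Ad K : ℝ[X]) : Prop :=
  MatchesOn F S Ad (InitRel K (Ad.natDegree - K.natDegree) (initLength F S Ad))

/-- `D` is a greatest common divisor of `P` and `P'`. -/
def IsGcd (D P P' : ℝ[X]) : Prop :=
  D ∣ P ∧ D ∣ P' ∧ ∀ E : ℝ[X], E ∣ P → E ∣ P' → E ∣ D

end ModelMatching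

/-!
The theorem compares the closed loop with the sequences `z 0, z 1, …` of delayed output values
(`z i` is the value of `δ_i`) that are killed by a linear polynomial `K`, the desired system itself
or its gcd with a common factor.

The expansion produced by the formal linear factors algorithm is an identity. Evaluated over a rule,
at delayed values `z` of the output and `v` of the input, every subtracted term is a companion
coefficient times a product of shifted values of its factors `L` (at `z`) and `M` (at `v`), so it
vanishes as soon as `L` kills `z` or `M` kills `v`. If `K` divides the evaluated factors, kills `z`,
and `v = S z`, then `K` also kills `v`, since linear polynomials commute. Hence the pure parts and,
with factors of one side only, the cross-products reduce to the remainders, which are zero over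
the rule (`PureLoop.ev_eq_zero`, `FLFLoop.ev_eq_zero`). When the linear part of the system is
exempted, what is left is `A z - B v` (`FLFLoop.ev_eq_linear`), which the equation `R K + Z B = A`
makes zero. A feedback `S = Q K` gives zero input, so that the pure `δ`-part alone matters. An
induction over a run needs only that pure and mixed polynomials stay so, which is seen on bidegrees.
In all three cases the closed-loop polynomial thus vanishes on all sequences killed by `K`
(`eval_eq_zero_of_mem_F1`, `eval_eq_zero_of_mem_F2`, `eval_eq_zero_of_mem_F3`).

The closed-loop polynomial has maximum delay `k_S`, so at a time `t ≥ k_S` it sees only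
`y(t), …, y(t - k_S)`. For an output of `K y = 0` these values extend to an infinite sequence killed
by `K` (`exists_seqAct_eq_zero`), whence such an output is an output of the closed loop
(`isLoopOutput_of_kills`). Uniqueness is an induction on time. For a proper factor `K` of the
desired system `C K`, the relations on the initial values propagate: `x = K y*` solves `C x = 0` and
vanishes on a window of `deg C` instants, and this recurrence can be run forward, because
`C(0) ≠ 0`, and backward (`eq_zero_of_linAct_eq_zero`).
-/

open scoped Polynomial

namespace ModelMatching

/-! ### Sequences of delayed values -/

/-- The action of a linear polynomial on a sequence `z 0, z 1, …` of delayed values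
(`z i` is the value of `δ_i`): the indeterminate is the shift `z ↦ (z 1, z 2, …)`. -/
noncomputable def seqAct (p : ℝ[X]) : Module.End ℝ (ℕ → ℝ) :=
  Polynomial.aeval (LinearMap.funLeft ℝ ℝ fun i : ℕ => i + 1) p

theorem aeval_funLeft_apply {ι : Type*} (f : ι → ι) (p : ℝ[X]) (z : ι → ℝ) (i : ι) :
    Polynomial.aeval (LinearMap.funLeft ℝ ℝ f) p z i = p.sum fun j a => a * z (f^[j] i) := by
  have h : ∀ (j : ℕ) (z : ι → ℝ) (i : ι),
      ((LinearMap.funLeft ℝ ℝ f) ^ j) z i = z (f^[j] i) := by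
    intro j
    induction j with
    | zero => intro z i; simp
    | succ j ih =>
      intro z i
      rw [pow_succ, Module.End.mul_apply, ih, LinearMap.funLeft_apply,
        Function.iterate_succ_apply']
  rw [Polynomial.aeval_eq_sum_range, Polynomial.sum_over_range _ (by simp)]
  simp [LinearMap.sum_apply, Finset.sum_apply, h]

theorem seqAct_apply (p : ℝ[X]) (z : ℕ → ℝ) (i : ℕ) :
    seqAct p z i = p.sum fun j a => a * z (i + j) := by
  rw [seqAct, aeval_funLeft_apply]
  congr 1
  funext j a
  rw [show (fun i : ℕ => i + 1)^[j] i = i + j from Nat.succ_iterate i j]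

theorem seqAct_mul (p q : ℝ[X]) (z : ℕ → ℝ) : seqAct (p * q) z = seqAct p (seqAct q z) := by
  simp [seqAct]

theorem seqAct_add (p q : ℝ[X]) : seqAct (p + q) = seqAct p + seqAct q := by
  simp [seqAct]

theorem seqAct_eq_zero_of_dvd {p q : ℝ[X]} {z : ℕ → ℝ} (h : seqAct p z = 0) (hpq : p ∣ q) :
    seqAct q z = 0 := by
  obtain ⟨r, rfl⟩ := hpq
  rw [mul_comm, seqAct_mul, h, map_zero]

theorem linAct_eq (p : ℝ[X]) (y : ℤ → ℝ) :
    linAct p y = Polynomial.aeval (LinearMap.funLeft ℝ ℝ fun t : ℤ => t - 1) p y := by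
  funext t
  rw [aeval_funLeft_apply, linAct]
  congr 1
  funext j a
  congr 2
  induction j with
  | zero => simp
  | succ j ih => rw [Function.iterate_succ_apply', ← ih]; push_cast; ring

theorem linAct_mul (p q : ℝ[X]) (y : ℤ → ℝ) : linAct (p * q) y = linAct p (linAct q y) := by
  simp [linAct_eq]

theorem linAct_eq_seqAct (p : ℝ[X]) (y : ℤ → ℝ) (t : ℤ) (i : ℕ) :
    linAct p y (t - i) = seqAct p (fun j => y (t - j)) i := by
  rw [seqAct_apply, linAct]
  congr 1
  funext j a
  push_cast
  rw [sub_sub]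

/-- The continuation of `z 0, …, z k` by the recurrence with characteristic polynomial `p`. -/
noncomputable def extend (p : ℝ[X]) (k : ℕ) (z : ℕ → ℝ) (n : ℕ) : ℝ :=
  if n ≤ k ∨ n < p.natDegree then z n
  else -(∑ j : Fin p.natDegree, p.coeff j * extend p k z (n - p.natDegree + j)) / p.leadingCoeff
termination_by n
decreasing_by omega

/-- A finite sequence that satisfies the relations of `p` as far as these make sense extends to a
sequence killed by `p`. -/
theorem exists_seqAct_eq_zero (p : ℝ[X]) (k : ℕ) (z : ℕ → ℝ)
    (hz : ∀ i, i + p.natDegree ≤ k → seqAct p z i = 0) :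
    ∃ z' : ℕ → ℝ, (∀ i ≤ k, z' i = z i) ∧ seqAct p z' = 0 := by
  rcases eq_or_ne p 0 with rfl | hp
  · exact ⟨z, fun _ _ => rfl, by simp [seqAct]⟩
  have hk : ∀ i ≤ k, extend p k z i = z i := fun i hi => by rw [extend, if_pos (Or.inl hi)]
  refine ⟨extend p k z, hk, ?_⟩
  funext i
  rw [seqAct_apply, Polynomial.sum_over_range _ (by simp)]
  by_cases hi : i + p.natDegree ≤ k
  · have := hz i hi
    rw [seqAct_apply, Polynomial.sum_over_range _ (by simp)] at this
    rw [Pi.zero_apply, ← this]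
    refine Finset.sum_congr rfl fun j hj => ?_
    rw [hk]
    rw [Finset.mem_range] at hj
    omega
  · rw [Finset.sum_range_succ, extend, if_neg (by omega), Polynomial.coeff_natDegree,
      mul_div_cancel₀ _ (Polynomial.leadingCoeff_ne_zero.2 hp), ← Finset.sum_range
        (fun j => p.coeff j * extend p k z (i + p.natDegree - p.natDegree + j)),
      Nat.add_sub_cancel, add_neg_cancel, Pi.zero_apply]

/-- A signal with `C x(t) = 0` for `t ≥ n` that vanishes on a window of `deg C` instants
vanishes from time `n - deg C` on, provided that the recurrence can be run in both directions. -/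
theorem eq_zero_of_linAct_eq_zero {C : ℝ[X]} (h0 : C.coeff 0 ≠ 0) {x : ℤ → ℝ} {n k : ℤ}
    (hC : ∀ t, n ≤ t → linAct C x t = 0) (hk : n ≤ k)
    (hx : ∀ t, k - C.natDegree ≤ t → t < k → x t = 0) :
    ∀ t, n - C.natDegree ≤ t → x t = 0 := by
  have hsum : ∀ t, n ≤ t → ∑ j ∈ Finset.range (C.natDegree + 1), C.coeff j * x (t - j) = 0 := by
    intro t ht
    have := hC t ht
    rwa [linAct, Polynomial.sum_over_range _ (by simp)] at this
  have hfwd : ∀ m : ℕ, ∀ t, k - C.natDegree ≤ t → t < k + m → x t = 0 := by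
    intro m
    induction m with
    | zero => simpa using hx
    | succ m ih =>
      intro t h1 h2
      by_cases h3 : t < k + m
      · exact ih t h1 h3
      have h := hsum t (by omega)
      rw [Finset.sum_range_succ', Finset.sum_eq_zero, zero_add] at h
      · simpa [h0] using h
      · intro j hj
        rw [Finset.mem_range] at hj
        rw [ih _ (by push_cast; omega) (by push_cast; omega), mul_zero]
  have hlead : C.leadingCoeff ≠ 0 := by
    rw [Polynomial.leadingCoeff_ne_zero]
    rintro rfl
    simp at h0
  have hbwd : ∀ m : ℕ, ∀ t, n - C.natDegree ≤ t → k - C.natDegree - m ≤ t → x t = 0 := by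
    intro m
    induction m with
    | zero => exact fun t _ h => hfwd (t - k + 1).toNat t (by simpa using h) (by omega)
    | succ m ih =>
      intro t h1 h2
      by_cases h3 : k - C.natDegree - m ≤ t
      · exact ih t h1 h3
      have h := hsum (t + C.natDegree) (by omega)
      rw [Finset.sum_range_succ, Finset.sum_eq_zero, zero_add] at h
      · simpa [hlead] using h
      · intro j hj
        rw [Finset.mem_range] at hj
        rw [ih _ (by omega) (by push_cast at h2; omega), mul_zero]
  exact fun t ht => hbwd (k - C.natDegree - t).toNat t ht (by omega)

/-! ### The closed loop -/

theorem eval_closedLoop (F : DEPoly ℝ) (S : ℝ[X]) (z w : ℕ → ℝ) :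
    MvPolynomial.eval (Sum.elim z w) (closedLoop F S) =
      MvPolynomial.eval (Sum.elim z (seqAct S z)) F := by
  rw [closedLoop, starProd, MvPolynomial.eval, MvPolynomial.eval₂Hom_bind₁]
  congr 2
  funext x
  rcases x with i | j
  · simp [shift]
  · simp only [Sum.elim_inr, shift, linOut, MvPolynomial.coe_eval₂Hom, MvPolynomial.eval₂_rename,
      seqAct_apply, Polynomial.sum_def]
    rw [MvPolynomial.eval₂_sum]
    refine Finset.sum_congr rfl fun k _ => ?_
    simp [add_comm]

theorem act_linAct (F : DEPoly ℝ) (S : ℝ[X]) (y : ℤ → ℝ) (t : ℤ) :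
    act F y (linAct S y) t =
      MvPolynomial.eval (Sum.elim (fun i : ℕ => y (t - i)) (seqAct S fun i : ℕ => y (t - i))) F := by
  simp only [act, linAct_eq_seqAct]

/-- If the closed-loop equation holds on all sequences killed by `K`, then every output of
`K y = 0` is an output of the closed loop. The equation at time `t ≥ k_S` sees the values
`y(t), …, y(t - k_S)` only, and these extend to a sequence killed by `K`. -/
theorem isLoopOutput_of_kills {F : DEPoly ℝ} {S K : ℝ[X]}
    (h : ∀ z : ℕ → ℝ, seqAct K z = 0 → MvPolynomial.eval (Sum.elim z (seqAct S z)) F = 0)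
    {y : ℤ → ℝ} (hy : IsLinOutput K y) : IsLoopOutput F S y := by
  refine ⟨hy.1, fun t ht => ?_⟩
  obtain ⟨z, hz, hKz⟩ := exists_seqAct_eq_zero K (maxOutDelay (closedLoop F S))
    (fun i : ℕ => y (t - i)) fun i hi => by
      rw [← linAct_eq_seqAct]
      exact hy.2 _ (by omega)
  rw [act_linAct, ← eval_closedLoop F S _ 0, ← h z hKz, ← eval_closedLoop F S z 0]
  refine MvPolynomial.eval₂Hom_congr' rfl (fun x hx _ => ?_) rfl
  rcases x with i | j
  · exact (hz i (Finset.le_sup (f := Sum.elim id (fun _ => 0)) hx)).symm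
  · rfl

/-- When the closed loop is solvable, its outputs are determined by their initial segments. -/
theorem LoopSolvable.eq_of_initial {F : DEPoly ℝ} {S : ℝ[X]} (hS : LoopSolvable F S)
    {y y' : ℤ → ℝ} (hy : IsLoopOutput F S y) (hy' : IsLoopOutput F S y') {k : ℕ}
    (hk : maxOutDelay (closedLoop F S) ≤ k) (h : ∀ t : ℤ, t < k → y t = y' t) : y = y' := by
  have key : ∀ n : ℕ, ∀ t : ℤ, t < k + n → y t = y' t := by
    intro n
    induction n with
    | zero => simpa using h
    | succ n ih =>
      intro t ht
      by_cases h3 : t < k + n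
      · exact ih t h3
      · exact hS y y' t hy.1 hy'.1 (by omega) (fun s hs => ih s (by push_cast at ht; omega))
          (hy.2 t (by omega)) (hy'.2 t (by omega))
  funext t
  exact key (t - k + 1).toNat t (by omega)

theorem matches_of_kills {F : DEPoly ℝ} {S Ad : ℝ[X]}
    (h : ∀ z : ℕ → ℝ, seqAct Ad z = 0 → MvPolynomial.eval (Sum.elim z (seqAct S z)) F = 0) :
    Matches F S Ad := fun _ hys _ =>
  ⟨isLoopOutput_of_kills h hys, fun hS _ hy hyy =>
    hS.eq_of_initial hy (isLoopOutput_of_kills h hys) (le_max_left _ _) hyy⟩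

theorem matchesRel_of_kills {F : DEPoly ℝ} {S Ad K : ℝ[X]} (h0 : Ad.coeff 0 ≠ 0) (hK : K ∣ Ad)
    (h : ∀ z : ℕ → ℝ, seqAct K z = 0 → MvPolynomial.eval (Sum.elim z (seqAct S z)) F = 0) :
    MatchesRel F S Ad K := by
  intro ys hys hI
  have hout : IsLinOutput K ys := by
    obtain ⟨C, rfl⟩ := hK
    have hne : K * C ≠ 0 := by
      intro hne
      simp [hne] at h0
    have hdeg := Polynomial.natDegree_mul (left_ne_zero_of_mul hne) (right_ne_zero_of_mul hne)
    rw [Polynomial.mul_coeff_zero] at h0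
    refine ⟨hys.1, fun t ht => ?_⟩
    refine eq_zero_of_linAct_eq_zero (C := C) (right_ne_zero_of_mul h0) (x := linAct K ys)
      (n := (K * C).natDegree) (k := initLength F S (K * C)) (fun t ht => ?_) ?_
      (fun t h1 h2 => hI t ?_ h2) t ?_
    · rw [← linAct_mul, mul_comm]
      exact hys.2 t ht
    · exact_mod_cast le_max_right _ _
    · rw [hdeg, Nat.add_sub_cancel_left]
      exact h1
    · rw [hdeg]
      push_cast
      omega
  exact ⟨isLoopOutput_of_kills h hout, fun hS _ hy hyy =>
    hS.eq_of_initial hy (isLoopOutput_of_kills h hout) (le_max_left _ _) hyy⟩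

/-! ### Bidegrees -/

/-- The pair of the `δ`-degree and the `ε`-degree of a term. -/
noncomputable def bideg : Term →+ ℕ × ℕ :=
  Finsupp.weight (R := ℕ) (Sum.elim (fun _ : ℕ => ((1, 0) : ℕ × ℕ)) fun _ : ℕ => (0, 1))

theorem bideg_fst_eq_zero {m : Term} : (bideg m).1 = 0 ↔ ∀ i, m (Sum.inl i) = 0 := by
  simp only [bideg, Finsupp.weight_apply, Finsupp.sum, Prod.fst_sum, Finset.sum_eq_zero_iff]
  constructor
  · intro h i
    by_contra hi
    exact hi (by simpa using h (Sum.inl i) (by simpa using hi))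
  · rintro h (i | j) _
    · simp [h]
    · simp

theorem bideg_snd_eq_zero {m : Term} : (bideg m).2 = 0 ↔ ∀ j, m (Sum.inr j) = 0 := by
  simp only [bideg, Finsupp.weight_apply, Finsupp.sum, Prod.snd_sum, Finset.sum_eq_zero_iff]
  constructor
  · intro h i
    by_contra hi
    exact hi (by simpa using h (Sum.inr i) (by simpa using hi))
  · rintro h (i | j) _
    · simp
    · simp [h]

theorem outIdx_eq_zero {m : Term} : outIdx m = 0 ↔ (bideg m).1 = 0 := by
  rw [bideg_fst_eq_zero, Finsupp.ext_iff]
  rfl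

theorem inIdx_eq_zero {m : Term} : inIdx m = 0 ↔ (bideg m).2 = 0 := by
  rw [bideg_snd_eq_zero, Finsupp.ext_iff]
  rfl

theorem bideg_reduceTerm (m : Term) : bideg (reduceTerm m) = bideg m := by
  simp only [bideg, reduceTerm, Finsupp.weight_apply]
  rw [Finsupp.sum_mapDomain_index (by simp) (by simp [add_smul])]
  congr 1
  funext x c
  rcases x with i | j <;> rfl

/-- The star-product of a term with linear polynomials has the bidegree of the term. -/
theorem bideg_starProd {R : Type*} [CommRing R] (s : Term) (p q : R[X]) {m : Term}
    (hm : m ∈ (starProd (MvPolynomial.monomial s (1 : R)) (linOut p) (linIn q)).support) :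
    bideg m = bideg s := by
  set w : ℕ ⊕ ℕ → ℕ × ℕ := Sum.elim (fun _ => (1, 0)) (fun _ => (0, 1)) with hw
  have key : MvPolynomial.IsWeightedHomogeneous w
      (starProd (MvPolynomial.monomial s (1 : R)) (linOut p) (linIn q)) (bideg s) := by
    rw [starProd, MvPolynomial.bind₁_monomial, map_one, one_mul, bideg, Finsupp.weight_apply]
    refine MvPolynomial.IsWeightedHomogeneous.prod _ _ _ fun x _ =>
      MvPolynomial.IsWeightedHomogeneous.pow ?_ _
    rcases x with i | j
    · simp only [Sum.elim_inl, shift, linOut, Polynomial.sum_def, map_sum, map_mul,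
        MvPolynomial.rename_C, MvPolynomial.rename_X, Sum.map_inl]
      exact MvPolynomial.IsWeightedHomogeneous.sum _ _ _ fun k _ =>
        MvPolynomial.IsWeightedHomogeneous.C_mul (MvPolynomial.isWeightedHomogeneous_X R w _) _
    · simp only [Sum.elim_inr, shift, linIn, Polynomial.sum_def, map_sum, map_mul,
        MvPolynomial.rename_C, MvPolynomial.rename_X, Sum.map_inr]
      exact MvPolynomial.IsWeightedHomogeneous.sum _ _ _ fun k _ =>
        MvPolynomial.IsWeightedHomogeneous.C_mul (MvPolynomial.isWeightedHomogeneous_X R w _) _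
  exact key (MvPolynomial.mem_support_iff.1 hm)

theorem coeff_outPart {R : Type*} [CommRing R] (A : DEPoly R) (m : Term) :
    (outPart A).coeff m = if (bideg m).2 = 0 then A.coeff m else 0 := by
  classical
  induction A using MvPolynomial.induction_on' with
  | add p q hp hq =>
    rw [outPart, map_add, MvPolynomial.coeff_add]
    rw [outPart] at hp hq
    rw [hp, hq, MvPolynomial.coeff_add]
    split_ifs <;> simp
  | monomial s a =>
    by_cases hs : (bideg s).2 = 0
    · have : outPart (MvPolynomial.monomial s a) = MvPolynomial.monomial s a := by
        rw [outPart, MvPolynomial.bind₁_monomial, MvPolynomial.monomial_eq, Finsupp.prod]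
        congr 1
        refine Finset.prod_congr rfl fun x hx => ?_
        rcases x with i | j
        · rfl
        · exact absurd (bideg_snd_eq_zero.1 hs j) (by simpa using hx)
      rw [this, MvPolynomial.coeff_monomial]
      split_ifs <;> simp_all
    · have : outPart (MvPolynomial.monomial s a) = 0 := by
        rw [bideg_snd_eq_zero] at hs
        push Not at hs
        obtain ⟨j, hj⟩ := hs
        rw [outPart, MvPolynomial.bind₁_monomial, Finset.prod_eq_zero (i := Sum.inr j), mul_zero]
        · simpa using hj
        · simp [hj]
      rw [this, MvPolynomial.coeff_monomial]
      split_ifs <;> simp_all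

theorem coeff_inPart {R : Type*} [CommRing R] (A : DEPoly R) (m : Term) :
    (inPart A).coeff m = if (bideg m).1 = 0 then A.coeff m else 0 := by
  classical
  induction A using MvPolynomial.induction_on' with
  | add p q hp hq =>
    rw [inPart, map_add, MvPolynomial.coeff_add]
    rw [inPart] at hp hq
    rw [hp, hq, MvPolynomial.coeff_add]
    split_ifs <;> simp
  | monomial s a =>
    by_cases hs : (bideg s).1 = 0
    · have : inPart (MvPolynomial.monomial s a) = MvPolynomial.monomial s a := by
        rw [inPart, MvPolynomial.bind₁_monomial, MvPolynomial.monomial_eq, Finsupp.prod]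
        congr 1
        refine Finset.prod_congr rfl fun x hx => ?_
        rcases x with i | j
        · exact absurd (bideg_fst_eq_zero.1 hs i) (by simpa using hx)
        · rfl
      rw [this, MvPolynomial.coeff_monomial]
      split_ifs <;> simp_all
    · have : inPart (MvPolynomial.monomial s a) = 0 := by
        rw [bideg_fst_eq_zero] at hs
        push Not at hs
        obtain ⟨j, hj⟩ := hs
        rw [inPart, MvPolynomial.bind₁_monomial, Finset.prod_eq_zero (i := Sum.inl j), mul_zero]
        · simpa using hj
        · simp [hj]
      rw [this, MvPolynomial.coeff_monomial]
      split_ifs <;> simp_all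

/-- All terms of `A` have a bidegree with the property `D`. -/
def HasShape (D : ℕ × ℕ → Prop) (A : DEPoly Coef) : Prop := ∀ m ∈ A.support, D (bideg m)

/-- The bidegrees of the terms of a pure polynomial without constant term: pure in the `δ_i` for
`b = true`, in the `ε_j` for `b = false`. -/
def PureDeg (b : Bool) (d : ℕ × ℕ) : Prop := cond b d.1 d.2 ≠ 0 ∧ cond b d.2 d.1 = 0

/-- The bidegrees of the cross-products. -/
def CrossDeg (d : ℕ × ℕ) : Prop := d.1 ≠ 0 ∧ d.2 ≠ 0

theorem eq_zero_of_bideg {m : Term} (h1 : (bideg m).1 = 0) (h2 : (bideg m).2 = 0) : m = 0 := by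
  ext x
  rcases x with i | j
  · exact bideg_fst_eq_zero.1 h1 i
  · exact bideg_snd_eq_zero.1 h2 j

theorem hasShape_outPart {A : DEPoly Coef} (hA : A.coeff 0 = 0) :
    HasShape (PureDeg true) (outPart A) := by
  intro m hm
  rw [MvPolynomial.mem_support_iff, coeff_outPart, ne_eq, ite_eq_right_iff, Classical.not_imp] at hm
  refine ⟨fun h => hm.2 ?_, hm.1⟩
  rw [eq_zero_of_bideg h hm.1, hA]

theorem hasShape_inPart {A : DEPoly Coef} (hA : A.coeff 0 = 0) :
    HasShape (PureDeg false) (inPart A) := by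
  intro m hm
  rw [MvPolynomial.mem_support_iff, coeff_inPart, ne_eq, ite_eq_right_iff, Classical.not_imp] at hm
  refine ⟨fun h => hm.2 ?_, hm.1⟩
  rw [eq_zero_of_bideg hm.1 h, hA]

theorem hasShape_crossPart {A : DEPoly Coef} (hA : A.coeff 0 = 0) :
    HasShape CrossDeg (crossPart A) := by
  intro m hm
  rw [MvPolynomial.mem_support_iff, crossPart, MvPolynomial.coeff_sub, MvPolynomial.coeff_sub,
    coeff_outPart, coeff_inPart] at hm
  by_cases h1 : (bideg m).1 = 0 <;> by_cases h2 : (bideg m).2 = 0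
  · simp [eq_zero_of_bideg h1 h2, hA] at hm
  · simp [h1, h2] at hm
  · simp [h1, h2] at hm
  · exact ⟨h1, h2⟩

/-- Factoring out keeps a polynomial pure: a term left without `δ` and without `ε` would be constant,
and constant terms are excluded. -/
theorem hasShape_of_factorOut {b : Bool} {R A : DEPoly Coef} (h : FactorOut R A)
    (hR : HasShape (PureDeg b) R) : HasShape (PureDeg b) A := by
  obtain ⟨κ, σ, rfl, h0, -⟩ := h
  intro m hm
  have hmem : Finsupp.single (Sum.inl 0) κ + Finsupp.single (Sum.inr 0) σ + m ∈
      (MvPolynomial.X (Sum.inl 0) ^ κ * MvPolynomial.X (Sum.inr 0) ^ σ * A : DEPoly Coef).support := by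
    rw [MvPolynomial.mem_support_iff, MvPolynomial.X_pow_eq_monomial,
      MvPolynomial.X_pow_eq_monomial, MvPolynomial.monomial_mul, MvPolynomial.coeff_monomial_mul]
    simpa using hm
  have hd := (hR _ hmem).2
  have hm0 : m ≠ 0 := by
    rintro rfl
    exact MvPolynomial.mem_support_iff.1 hm h0
  rw [map_add] at hd
  cases b
  · have h2 : (bideg m).1 = 0 := by simp at hd; exact hd.2
    exact ⟨fun h => hm0 (eq_zero_of_bideg h2 h), h2⟩
  · have h2 : (bideg m).2 = 0 := by simp at hd; exact hd.2
    exact ⟨fun h => hm0 (eq_zero_of_bideg h h2), h2⟩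

theorem hasShape_homogeneousComponent {D : ℕ × ℕ → Prop} {A : DEPoly Coef} (hA : HasShape D A)
    (n : ℕ) : HasShape D (MvPolynomial.homogeneousComponent n A) := by
  intro m hm
  rw [MvPolynomial.support_homogeneousComponent, Finset.mem_filter] at hm
  exact hA m hm.1

theorem HasShape.sub {D : ℕ × ℕ → Prop} {A A' : DEPoly Coef} (hA : HasShape D A)
    (hA' : HasShape D A') : HasShape D (A - A') := by
  classical
  intro m hm
  rcases Finset.mem_union.1 (MvPolynomial.support_sub _ _ _ hm) with h | h
  · exact hA m h
  · exact hA' m h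

/-- A loop of the subroutine REMAINDER subtracts polynomials with the bidegree of one of the terms
that are present. -/
theorem HasShape.step {D : ℕ × ℕ → Prop} {A : DEPoly Coef} (hA : HasShape D A) {m : Term}
    (hm : m ∈ A.support) (c : Coef) (p q : Coef[X]) :
    HasShape D (A - MvPolynomial.C c *
      starProd (MvPolynomial.monomial (reduceTerm m) 1) (linOut p) (linIn q)) := by
  refine hA.sub fun m' hm' => ?_
  rw [MvPolynomial.mem_support_iff, MvPolynomial.coeff_C_mul] at hm'
  rw [bideg_starProd _ p q (MvPolynomial.mem_support_iff.2 (right_ne_zero_of_mul hm')),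
    bideg_reduceTerm]
  exact hA m hm

/-! ### Evaluation over a rule -/

/-- The value of a `δε`-polynomial over the rule `ρ` at the delayed values `z` of the output and
`v` of the input. -/
noncomputable def ev (ρ : Rule) (z v : ℕ → ℝ) : DEPoly Coef →+* ℝ :=
  MvPolynomial.eval₂Hom (MvPolynomial.eval ρ) (Sum.elim z v)

theorem ev_eq_zero_of_map {ρ : Rule} {R : DEPoly Coef}
    (h : MvPolynomial.map (MvPolynomial.eval ρ) R = 0) (z v : ℕ → ℝ) : ev ρ z v R = 0 := by
  rw [ev, MvPolynomial.coe_eval₂Hom, MvPolynomial.eval₂_eq_eval_map, h, map_zero]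

theorem ev_map_C (ρ : Rule) (z v : ℕ → ℝ) (F : DEPoly ℝ) :
    ev ρ z v (MvPolynomial.map MvPolynomial.C F) = MvPolynomial.eval (Sum.elim z v) F := by
  rw [ev, MvPolynomial.coe_eval₂Hom, MvPolynomial.eval₂_map]
  congr 1
  ext x
  simp

theorem ev_factorOut {R A : DEPoly Coef} (h : FactorOut R A) {ρ : Rule} {z v : ℕ → ℝ}
    (hA : ev ρ z v A = 0) : ev ρ z v R = 0 := by
  obtain ⟨κ, σ, rfl, -⟩ := h
  rw [map_mul, hA, mul_zero]

theorem seqAct_map (ρ : Rule) (p : Coef[X]) (z : ℕ → ℝ) (i : ℕ) :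
    seqAct (p.map (MvPolynomial.eval ρ)) z i =
      p.sum fun j a => MvPolynomial.eval ρ a * z (i + j) := by
  rw [seqAct_apply, Polynomial.sum_over_range' _ (by simp) (p.natDegree + 1)
    (Nat.lt_succ_of_le Polynomial.natDegree_map_le), Polynomial.sum_over_range _ (by simp)]
  simp

/-- A term of the expansion that contains some `δ_i` vanishes as soon as its factor `L` kills the
values of the output. -/
theorem ev_starProd_eq_zero_left {ρ : Rule} {z : ℕ → ℝ} (v : ℕ → ℝ) {m : Term}
    (hm : (bideg m).1 ≠ 0) {p : Coef[X]} (hp : seqAct (p.map (MvPolynomial.eval ρ)) z = 0)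
    (q : Coef[X]) :
    ev ρ z v (starProd (MvPolynomial.monomial (reduceTerm m) 1) (linOut p) (linIn q)) = 0 := by
  rw [← bideg_reduceTerm, ne_eq, bideg_fst_eq_zero, not_forall] at hm
  obtain ⟨i, hi⟩ := hm
  rw [starProd, MvPolynomial.bind₁_monomial, map_one, one_mul, map_prod,
    Finset.prod_eq_zero (i := Sum.inl i) (by simpa using hi)]
  rw [map_pow, pow_eq_zero_iff hi]
  refine Eq.trans ?_ (congr_fun hp i)
  rw [seqAct_map]
  simp only [Sum.elim_inl, shift, linOut, Polynomial.sum_def, map_sum, map_mul,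
    MvPolynomial.rename_C, MvPolynomial.rename_X, Sum.map_inl]
  simp [ev, add_comm]

theorem ev_starProd_eq_zero_right {ρ : Rule} (z : ℕ → ℝ) {v : ℕ → ℝ} {m : Term}
    (hm : (bideg m).2 ≠ 0) (p : Coef[X]) {q : Coef[X]}
    (hq : seqAct (q.map (MvPolynomial.eval ρ)) v = 0) :
    ev ρ z v (starProd (MvPolynomial.monomial (reduceTerm m) 1) (linOut p) (linIn q)) = 0 := by
  rw [← bideg_reduceTerm, ne_eq, bideg_snd_eq_zero, not_forall] at hm
  obtain ⟨i, hi⟩ := hm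
  rw [starProd, MvPolynomial.bind₁_monomial, map_one, one_mul, map_prod,
    Finset.prod_eq_zero (i := Sum.inr i) (by simpa using hi)]
  rw [map_pow, pow_eq_zero_iff hi]
  refine Eq.trans ?_ (congr_fun hq i)
  rw [seqAct_map]
  simp only [Sum.elim_inr, shift, linIn, Polynomial.sum_def, map_sum, map_mul,
    MvPolynomial.rename_C, MvPolynomial.rename_X, Sum.map_inr]
  simp [ev, add_comm]

/-- The value of a linear `δε`-polynomial, by its `δ`- and `ε`-parts. -/
theorem eval₂_eq_of_isHomogeneous_one {R : Type*} [CommRing R] (f : R →+* ℝ) (z v : ℕ → ℝ)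
    {B : DEPoly R} (hB : B.IsHomogeneous 1) :
    MvPolynomial.eval₂ f (Sum.elim z v) B =
      seqAct ((MvPolynomial.aeval (Sum.elim (fun i : ℕ => (Polynomial.X ^ i : R[X]))
        (fun _ : ℕ => 0)) B).map f) z 0 +
      seqAct ((MvPolynomial.aeval (Sum.elim (fun _ : ℕ => 0)
        (fun j : ℕ => (Polynomial.X ^ j : R[X]))) B).map f) v 0 := by
  have hX : ∀ (a : R) (k : ℕ) (z : ℕ → ℝ),
      seqAct ((Polynomial.C a * Polynomial.X ^ k).map f) z 0 = f a * z k := by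
    intro a k z
    rw [seqAct_apply, Polynomial.map_mul, Polynomial.map_C, Polynomial.map_pow, Polynomial.map_X,
      Polynomial.C_mul_X_pow_eq_monomial, Polynomial.sum_monomial_index _ _ (by simp), zero_add]
  conv_lhs => rw [B.as_sum]
  conv_rhs => rw [B.as_sum]
  rw [MvPolynomial.eval₂_sum, map_sum, map_sum, Polynomial.map_sum, Polynomial.map_sum]
  simp only [seqAct, map_sum, LinearMap.sum_apply, Finset.sum_apply]
  rw [← Finset.sum_add_distrib]
  refine Finset.sum_congr rfl fun m hm => ?_
  have hdeg := hB.degree_eq_sum_deg_support hm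
  obtain ⟨x, rfl⟩ : ∃ x, m = Finsupp.single x 1 := (Finsupp.sum_eq_one_iff m).1 hdeg.symm
  simp only [seqAct] at hX
  rcases x with i | j
  · simp [MvPolynomial.eval₂_monomial, MvPolynomial.aeval_monomial, Polynomial.algebraMap_eq,
      ← hX _ i z]
  · simp [MvPolynomial.eval₂_monomial, MvPolynomial.aeval_monomial, Polynomial.algebraMap_eq,
      ← hX _ j v]

theorem ev_linear_of_pure {b : Bool} {A : DEPoly Coef} (hA : HasShape (PureDeg b) A)
    (ρ : Rule) (z v : ℕ → ℝ) :
    ev ρ z v (MvPolynomial.homogeneousComponent 1 A) =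
      seqAct ((cond b (outLinPart A) (inLinPart A)).map (MvPolynomial.eval ρ)) (cond b z v) 0 := by
  have h := eval₂_eq_of_isHomogeneous_one (MvPolynomial.eval ρ) z v
    (MvPolynomial.homogeneousComponent_isHomogeneous 1 A)
  have hshape := hasShape_homogeneousComponent hA 1
  rw [ev, MvPolynomial.coe_eval₂Hom, h]
  cases b
  · have h0 : outLinPart A = 0 := MvPolynomial.eval₂Hom_eq_zero _ _ _ fun d hd => by
      obtain ⟨j, hj⟩ := not_forall.1 (mt bideg_snd_eq_zero.2
        (hshape d (MvPolynomial.mem_support_iff.2 hd)).1)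
      exact ⟨Sum.inr j, by simpa using hj, rfl⟩
    rw [outLinPart] at h0
    rw [h0, Polynomial.map_zero]
    simp [seqAct, inLinPart]
  · have h0 : inLinPart A = 0 := MvPolynomial.eval₂Hom_eq_zero _ _ _ fun d hd => by
      obtain ⟨i, hi⟩ := not_forall.1 (mt bideg_fst_eq_zero.2
        (hshape d (MvPolynomial.mem_support_iff.2 hd)).1)
      exact ⟨Sum.inl i, by simpa using hi, rfl⟩
    rw [inLinPart] at h0
    rw [h0, Polynomial.map_zero]
    simp [seqAct, outLinPart]

/-- A term of degree one is pure. -/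
theorem linear_eq_zero_of_cross {A : DEPoly Coef} (hA : HasShape CrossDeg A) :
    MvPolynomial.homogeneousComponent 1 A = 0 := by
  refine MvPolynomial.homogeneousComponent_eq_zero' 1 A fun m hm hdeg => ?_
  obtain ⟨x, rfl⟩ : ∃ x, m = Finsupp.single x 1 := (Finsupp.sum_eq_one_iff m).1 hdeg
  have h := hA _ hm
  rcases x with i | j
  · exact h.2 (by simp [bideg, Finsupp.weight_single])
  · exact h.1 (by simp [bideg, Finsupp.weight_single])

/-! ### Runs of the algorithm over a rule -/

/-- Over `ρ`, the members of `𝓕` with nonzero companion coefficient kill the sequence `z`. -/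
def Kills (𝓕 : Set Factor) (ρ : Rule) (z : ℕ → ℝ) : Prop :=
  ∀ J ∈ 𝓕, J.ccAt ρ ≠ 0 → seqAct (J.evalAt ρ) z = 0

theorem Kills.mono {𝓕 𝓖 : Set Factor} {ρ : Rule} {z : ℕ → ℝ} (h : Kills 𝓖 ρ z) (hs : 𝓕 ⊆ 𝓖) :
    Kills 𝓕 ρ z := fun J hJ => h J (hs hJ)

theorem CommonFactor.kills {𝓕 : Set Factor} {ρ : Rule} {Φ : ℝ[X]} (h : CommonFactor 𝓕 ρ Φ)
    {z : ℕ → ℝ} (hz : seqAct Φ z = 0) : Kills 𝓕 ρ z := fun J hJ hc =>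
  seqAct_eq_zero_of_dvd hz (h J hJ hc)

theorem RemLoop.labels {u om h l : ℕ} {A R : DEPoly Coef} {L M : Set Factor}
    (hr : RemLoop u om h l A L M R) :
    (∀ J ∈ L, J.lam ≠ 0 ∧ J.idx = u ∧ J.h = h) ∧ ∀ J ∈ M, J.lam ≠ 0 ∧ J.idx = om ∧ J.h = h := by
  induction hr with
  | done => simp
  | step hm hp hq hrec ih =>
    constructor
    · rintro J (⟨-, rfl⟩ | hJ)
      · simp
      · exact ih.1 J hJ
    · rintro J (⟨-, rfl⟩ | hJ)
      · simp
      · exact ih.2 J hJ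

/-- Over a rule, the subroutine REMAINDER does not change the value of a polynomial if each
subtracted term contains a factor that vanishes. -/
theorem RemLoop.ev_eq {D : ℕ × ℕ → Prop} {ρ : Rule} {z v : ℕ → ℝ} {u om h l : ℕ}
    {A R : DEPoly Coef} {L M : Set Factor} (hr : RemLoop u om h l A L M R) (hA : HasShape D A)
    (hk : ((∀ d, D d → d.1 ≠ 0) ∧ Kills L ρ z) ∨ ((∀ d, D d → d.2 ≠ 0) ∧ Kills M ρ v)) :
    HasShape D R ∧ ev ρ z v A = ev ρ z v R := by
  induction hr with
  | done => exact ⟨hA, rfl⟩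
  | @step l A R L M m p q hm hp hq hrec ih =>
    have hD := hA m hm.1
    obtain ⟨h1, h2⟩ := ih (hA.step hm.1 _ p q) (hk.imp
      (fun hk => ⟨hk.1, hk.2.mono Set.subset_union_right⟩)
      (fun hk => ⟨hk.1, hk.2.mono Set.subset_union_right⟩))
    refine ⟨h1, ?_⟩
    rw [← h2, map_sub, map_mul, eq_comm, sub_eq_self, mul_eq_zero, or_iff_not_imp_left]
    intro hc
    have hc' : MvPolynomial.eval ρ (A.coeff m) ≠ 0 := by simpa [ev] using hc
    rcases hk with ⟨hd, hk⟩ | ⟨hd, hk⟩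
    · exact ev_starProd_eq_zero_left v (hd _ hD)
        (hk ⟨l + 1, u, h, p, A.coeff m⟩ (Or.inl ⟨mt outIdx_eq_zero.1 (hd _ hD), rfl⟩) hc') q
    · exact ev_starProd_eq_zero_right z (hd _ hD) p
        (hk ⟨l + 1, om, h, q, A.coeff m⟩ (Or.inl ⟨mt inIdx_eq_zero.1 (hd _ hD), rfl⟩) hc')

theorem Remainder.labels {u om h : ℕ} {A R : DEPoly Coef} {L M : Set Factor}
    (hr : Remainder u om h A L M R) :
    (∀ J ∈ L, J.idx = u ∧ J.h = h) ∧ ∀ J ∈ M, J.idx = om ∧ J.h = h := by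
  obtain ⟨L', M', hloop, rfl, rfl⟩ := hr
  constructor
  · rintro J (⟨-, -, rfl⟩ | hJ)
    · simp
    · exact (hloop.labels.1 J hJ).2
  · rintro J (⟨-, -, rfl⟩ | hJ)
    · simp
    · exact (hloop.labels.2 J hJ).2

theorem Remainder.ev_eq_of_pure {b : Bool} {n h : ℕ} {A R : DEPoly Coef} {L M : Set Factor}
    (hr : Remainder (cond b n 0) (cond b 0 n) h A L M R) (hA : HasShape (PureDeg b) A)
    {ρ : Rule} {z v : ℕ → ℝ}
    (hk : Kills {J ∈ cond b L M | ¬(J.lam = 0 ∧ J.idx = n)} ρ (cond b z v)) :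
    HasShape (PureDeg b) R ∧
      ev ρ z v A = ev ρ z v (MvPolynomial.homogeneousComponent 1 A) + ev ρ z v R := by
  obtain ⟨L', M', hloop, rfl, rfl⟩ := hr
  have hs := hA.sub (hasShape_homogeneousComponent hA 1)
  have hlab := hloop.labels
  have := hloop.ev_eq (ρ := ρ) (z := z) (v := v) hs (by
    cases b
    · exact Or.inr ⟨fun d hd => hd.1, hk.mono fun J hJ =>
        ⟨Or.inr hJ, fun h0 => (hlab.2 J hJ).1 h0.1⟩⟩
    · exact Or.inl ⟨fun d hd => hd.1, hk.mono fun J hJ =>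
        ⟨Or.inr hJ, fun h0 => (hlab.1 J hJ).1 h0.1⟩⟩)
  refine ⟨this.1, ?_⟩
  rw [← this.2, map_sub, add_sub_cancel]

/-- A nonzero linear part is itself recorded as a factor, with companion coefficient `1`. -/
theorem Remainder.ev_linear_eq_zero {b : Bool} {n h : ℕ} (hn : n ≠ 0) {A R : DEPoly Coef}
    {L M : Set Factor} (hr : Remainder (cond b n 0) (cond b 0 n) h A L M R)
    (hA : HasShape (PureDeg b) A) {ρ : Rule} {z v : ℕ → ℝ}
    (hk : Kills (cond b L M) ρ (cond b z v)) :
    ev ρ z v (MvPolynomial.homogeneousComponent 1 A) = 0 := by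
  by_cases h0 : MvPolynomial.homogeneousComponent 1 A = 0
  · rw [h0, map_zero]
  obtain ⟨L', M', hloop, rfl, rfl⟩ := hr
  rw [ev_linear_of_pure hA]
  refine congr_fun (hk ⟨0, n, h, cond b (outLinPart A) (inLinPart A), 1⟩ ?_ ?_) 0
  · cases b
    · exact Or.inl ⟨h0, rfl, rfl⟩
    · exact Or.inl ⟨h0, hn, rfl⟩
  · simp [Factor.ccAt]

theorem PureLoop.labels {b : Bool} {h n : ℕ} {A R : DEPoly Coef} {L M : Set Factor}
    (hp : PureLoop b h n A L M R) :
    (∀ J ∈ cond b L M, n ≤ J.idx) ∧ (∀ J ∈ L, J.h = h) ∧ ∀ J ∈ M, J.h = h := by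
  induction hp with
  | last hrem =>
    refine ⟨fun J hJ => ?_, fun J hJ => (hrem.labels.1 J hJ).2,
      fun J hJ => (hrem.labels.2 J hJ).2⟩
    cases b
    · exact (hrem.labels.2 J hJ).1.ge
    · exact (hrem.labels.1 J hJ).1.ge
  | again hrem _ _ _ ih =>
    refine ⟨fun J hJ => ?_, ?_, ?_⟩
    · cases b
      · exact hJ.elim (fun hJ => (hrem.labels.2 J hJ).1.ge) fun hJ => Nat.le_of_succ_le (ih.1 J hJ)
      · exact hJ.elim (fun hJ => (hrem.labels.1 J hJ).1.ge) fun hJ => Nat.le_of_succ_le (ih.1 J hJ)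
    · rintro J (hJ | hJ)
      · exact (hrem.labels.1 J hJ).2
      · exact ih.2.1 J hJ
    · rintro J (hJ | hJ)
      · exact (hrem.labels.2 J hJ).2
      · exact ih.2.2 J hJ

theorem cond_union (b : Bool) (L M L' M' : Set Factor) :
    cond b (L ∪ L') (M ∪ M') = cond b L M ∪ cond b L' M' := by
  cases b <;> rfl

/-- A pure polynomial vanishes if its recorded factors and its remainder do. -/
theorem PureLoop.ev_eq_zero {b : Bool} {h n : ℕ} {A R : DEPoly Coef} {L M : Set Factor}
    (hp : PureLoop b h n A L M R) (hn : n ≠ 0) (hA : HasShape (PureDeg b) A) {ρ : Rule}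
    {z v : ℕ → ℝ} (hk : Kills (cond b L M) ρ (cond b z v)) (hR : ev ρ z v R = 0) :
    ev ρ z v A = 0 := by
  induction hp with
  | last hrem hfac =>
    rw [(hrem.ev_eq_of_pure hA (hk.mono (Set.sep_subset _ _))).2, hrem.ev_linear_eq_zero hn hA hk,
      ev_factorOut hfac hR, add_zero]
  | again hrem hfac _ _ ih =>
    rw [cond_union] at hk
    have hk' := hk.mono Set.subset_union_left
    have h1 := hrem.ev_eq_of_pure hA (hk'.mono (Set.sep_subset _ _))
    rw [h1.2, hrem.ev_linear_eq_zero hn hA hk', zero_add]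
    exact ev_factorOut hfac (ih (Nat.succ_ne_zero _) (hasShape_of_factorOut hfac h1.1)
      (hk.mono Set.subset_union_right) hR)

/-- A pure polynomial reduces to its linear part if the other recorded factors and the remainder
vanish. -/
theorem PureLoop.ev_eq_linear {b : Bool} {h n : ℕ} {A R : DEPoly Coef} {L M : Set Factor}
    (hp : PureLoop b h n A L M R) (hA : HasShape (PureDeg b) A) {ρ : Rule} {z v : ℕ → ℝ}
    (hk : Kills {J ∈ cond b L M | ¬(J.lam = 0 ∧ J.idx = n)} ρ (cond b z v))
    (hR : ev ρ z v R = 0) :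
    ev ρ z v A = ev ρ z v (MvPolynomial.homogeneousComponent 1 A) := by
  cases hp with
  | last hrem hfac => rw [(hrem.ev_eq_of_pure hA hk).2, ev_factorOut hfac hR, add_zero]
  | again hrem hfac _ hrec =>
    rw [cond_union] at hk
    have h1 := hrem.ev_eq_of_pure hA (hk.mono fun J hJ => ⟨Or.inl hJ.1, hJ.2⟩)
    rw [h1.2, add_eq_left]
    refine ev_factorOut hfac (hrec.ev_eq_zero (Nat.succ_ne_zero _)
      (hasShape_of_factorOut hfac h1.1) (hk.mono fun J hJ => ⟨Or.inr hJ, fun h0 => ?_⟩) hR)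
    exact absurd (hrec.labels.1 J hJ) (by omega)

/-- The cross-products vanish as soon as the factors on one of the two sides do. -/
theorem Remainder.ev_eq_of_cross {h : ℕ} {A R : DEPoly Coef} {L M : Set Factor}
    (hr : Remainder 0 0 h A L M R) (hA : HasShape CrossDeg A) {ρ : Rule} {z v : ℕ → ℝ}
    (hk : Kills L ρ z ∨ Kills M ρ v) : ev ρ z v A = ev ρ z v R := by
  obtain ⟨L', M', hloop, rfl, rfl⟩ := hr
  have h0 := linear_eq_zero_of_cross hA
  rw [h0, sub_zero] at hloop
  exact (hloop.ev_eq hA (hk.imp (fun hk => ⟨fun d hd => hd.1, hk.mono Set.subset_union_right⟩)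
    (fun hk => ⟨fun d hd => hd.2, hk.mono Set.subset_union_right⟩))).2

theorem FLFLoop.labels {h : ℕ} {A : DEPoly Coef} {out : FLFOutput} (hl : FLFLoop h A out) :
    (∀ J ∈ out.L, h ≤ J.h) ∧ ∀ J ∈ out.M, h ≤ J.h := by
  induction hl with
  | last hd he =>
    constructor
    · rintro J (hJ | hJ)
      · exact (hd.labels.2.1 J hJ).ge
      · exact (he.labels.2.1 J hJ).ge
    · rintro J (hJ | hJ)
      · exact (hd.labels.2.2 J hJ).ge
      · exact (he.labels.2.2 J hJ).ge
  | next hd he _ hrem _ _ ih =>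
    constructor
    · rintro J (((hJ | hJ) | hJ) | hJ)
      · exact (hd.labels.2.1 J hJ).ge
      · exact (he.labels.2.1 J hJ).ge
      · exact (hrem.labels.1 J hJ).2.ge
      · exact Nat.le_of_succ_le (ih.1 J hJ)
    · rintro J (((hJ | hJ) | hJ) | hJ)
      · exact (hd.labels.2.2 J hJ).ge
      · exact (he.labels.2.2 J hJ).ge
      · exact (hrem.labels.2 J hJ).2.ge
      · exact Nat.le_of_succ_le (ih.2 J hJ)

theorem ev_eq_add (ρ : Rule) (z v : ℕ → ℝ) (A : DEPoly Coef) :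
    ev ρ z v A = ev ρ z v (outPart A) + ev ρ z v (inPart A) + ev ρ z v (crossPart A) := by
  rw [crossPart, map_sub, map_sub]
  ring

/-- A system vanishes if its recorded factors and its remainders do; of the factors of the
cross-products, those on one side suffice. -/
theorem FLFLoop.ev_eq_zero {h : ℕ} {A : DEPoly Coef} {out : FLFOutput} (hl : FLFLoop h A out)
    (hA : A.coeff 0 = 0) {ρ : Rule} {z v : ℕ → ℝ} (hRV : ρ ∈ out.RV)
    (hL : Kills (noCross out.L) ρ z) (hM : Kills (noCross out.M) ρ v)
    (hX : Kills out.L ρ z ∨ Kills out.M ρ v) : ev ρ z v A = 0 := by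
  induction hl with
  | last hd he =>
    rw [ev_eq_add, hd.ev_eq_zero one_ne_zero (hasShape_outPart hA) (hL.mono fun J hJ =>
        ⟨Or.inl hJ, Nat.one_le_iff_ne_zero.1 (hd.labels.1 J hJ)⟩)
        (ev_eq_zero_of_map (hRV.1 _ rfl) _ _),
      he.ev_eq_zero one_ne_zero (hasShape_inPart hA) (hM.mono fun J hJ =>
        ⟨Or.inr hJ, Nat.one_le_iff_ne_zero.1 (he.labels.1 J hJ)⟩)
        (ev_eq_zero_of_map (hRV.2.1 _ rfl) _ _), ev_eq_zero_of_map hRV.2.2]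
    simp
  | next hd he _ hrem hfac _ ih =>
    rw [ev_eq_add, hd.ev_eq_zero one_ne_zero (hasShape_outPart hA) (hL.mono fun J hJ =>
        ⟨Or.inl (Or.inl (Or.inl hJ)), Nat.one_le_iff_ne_zero.1 (hd.labels.1 J hJ)⟩)
        (ev_eq_zero_of_map (hRV.1 _ (Or.inl rfl)) _ _),
      he.ev_eq_zero one_ne_zero (hasShape_inPart hA) (hM.mono fun J hJ =>
        ⟨Or.inl (Or.inl (Or.inr hJ)), Nat.one_le_iff_ne_zero.1 (he.labels.1 J hJ)⟩)
        (ev_eq_zero_of_map (hRV.2.1 _ (Or.inl rfl)) _ _),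
      hrem.ev_eq_of_cross (hasShape_crossPart hA) (hX.imp
        (fun hk => hk.mono fun J hJ => Or.inl (Or.inr hJ))
        (fun hk => hk.mono fun J hJ => Or.inl (Or.inr hJ))),
      ev_factorOut hfac (ih hfac.choose_spec.choose_spec.2.1
        ⟨fun x hx => hRV.1 x (Or.inr hx), fun x hx => hRV.2.1 x (Or.inr hx), hRV.2.2⟩
        (hL.mono fun J hJ => ⟨Or.inr hJ.1, hJ.2⟩) (hM.mono fun J hJ => ⟨Or.inr hJ.1, hJ.2⟩)
        (hX.imp (fun hk => hk.mono fun J hJ => Or.inr hJ)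
          (fun hk => hk.mono fun J hJ => Or.inr hJ)))]
    simp

/-- A system reduces to its linear part if the remainders and the factors other than the linear
part vanish. -/
theorem FLFLoop.ev_eq_linear {A : DEPoly Coef} {out : FLFOutput} (hl : FLFLoop 0 A out)
    (hA : A.coeff 0 = 0) {ρ : Rule} {z v : ℕ → ℝ} (hRV : ρ ∈ out.RV)
    (hL : Kills (starred (noCross out.L)) ρ z) (hM : Kills (starred (noCross out.M)) ρ v)
    (hX : Kills (starred out.L) ρ z ∨ Kills (starred out.M) ρ v) :
    ev ρ z v A = ev ρ z v (MvPolynomial.homogeneousComponent 1 A) := by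
  have hlin : ev ρ z v (MvPolynomial.homogeneousComponent 1 A) =
      ev ρ z v (MvPolynomial.homogeneousComponent 1 (outPart A)) +
        ev ρ z v (MvPolynomial.homogeneousComponent 1 (inPart A)) := by
    have h0 := linear_eq_zero_of_cross (hasShape_crossPart hA)
    rw [crossPart, map_sub, map_sub, sub_sub, sub_eq_zero] at h0
    rw [h0, map_add]
  rw [hlin]
  cases hl with
  | last hd he =>
    rw [ev_eq_add, hd.ev_eq_linear (hasShape_outPart hA) (hL.mono fun J hJ =>
        ⟨⟨Or.inl hJ.1, Nat.one_le_iff_ne_zero.1 (hd.labels.1 J hJ.1)⟩,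
          fun h0 => hJ.2 ⟨h0.1, h0.2.1⟩⟩)
        (ev_eq_zero_of_map (hRV.1 _ rfl) _ _),
      he.ev_eq_linear (hasShape_inPart hA) (hM.mono fun J hJ =>
        ⟨⟨Or.inr hJ.1, Nat.one_le_iff_ne_zero.1 (he.labels.1 J hJ.1)⟩,
          fun h0 => hJ.2 ⟨h0.1, h0.2.1⟩⟩)
        (ev_eq_zero_of_map (hRV.2.1 _ rfl) _ _), ev_eq_zero_of_map hRV.2.2, add_zero]
  | next hd he _ hrem hfac hrec =>
    -- The label `(0, 1, 0)` occurs neither in the cross-products, where `idx = 0`, nor in later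
    -- passes, where `h ≥ 1`.
    have hlab := hrec.labels
    have hs : ∀ J : Factor, 0 + 1 ≤ J.h → ¬(J.lam = 0 ∧ J.idx = 1 ∧ J.h = 0) := by omega
    rw [ev_eq_add, hd.ev_eq_linear (hasShape_outPart hA) (hL.mono fun J hJ =>
        ⟨⟨Or.inl (Or.inl (Or.inl hJ.1)), Nat.one_le_iff_ne_zero.1 (hd.labels.1 J hJ.1)⟩,
          fun h0 => hJ.2 ⟨h0.1, h0.2.1⟩⟩)
        (ev_eq_zero_of_map (hRV.1 _ (Or.inl rfl)) _ _),
      he.ev_eq_linear (hasShape_inPart hA) (hM.mono fun J hJ =>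
        ⟨⟨Or.inl (Or.inl (Or.inr hJ.1)), Nat.one_le_iff_ne_zero.1 (he.labels.1 J hJ.1)⟩,
          fun h0 => hJ.2 ⟨h0.1, h0.2.1⟩⟩)
        (ev_eq_zero_of_map (hRV.2.1 _ (Or.inl rfl)) _ _),
      hrem.ev_eq_of_cross (hasShape_crossPart hA) (hX.imp
        (fun hk => hk.mono fun J hJ => ⟨Or.inl (Or.inr hJ),
          fun h0 => by have := (hrem.labels.1 J hJ).1; omega⟩)
        (fun hk => hk.mono fun J hJ => ⟨Or.inl (Or.inr hJ),
          fun h0 => by have := (hrem.labels.2 J hJ).1; omega⟩)),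
      ev_factorOut hfac (hrec.ev_eq_zero hfac.choose_spec.choose_spec.2.1
        ⟨fun x hx => hRV.1 x (Or.inr hx), fun x hx => hRV.2.1 x (Or.inr hx), hRV.2.2⟩
        (hL.mono fun J hJ => ⟨⟨Or.inr hJ.1, hJ.2⟩, hs J (hlab.1 J hJ.1)⟩)
        (hM.mono fun J hJ => ⟨⟨Or.inr hJ.1, hJ.2⟩, hs J (hlab.2 J hJ.1)⟩)
        (hX.imp (fun hk => hk.mono fun J hJ => ⟨Or.inr hJ, hs J (hlab.1 J hJ)⟩)
          (fun hk => hk.mono fun J hJ => ⟨Or.inr hJ, hs J (hlab.2 J hJ)⟩))), add_zero]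

theorem FLFLoop.ev_outPart_eq_zero {A : DEPoly Coef} {out : FLFOutput} (hl : FLFLoop 0 A out)
    (hA : A.coeff 0 = 0) {ρ : Rule} {z : ℕ → ℝ} (v : ℕ → ℝ) (hDR : ρ ∈ out.DR)
    (hL : Kills out.Ldelta ρ z) : ev ρ z v (outPart A) = 0 := by
  cases hl with
  | last hd =>
    exact hd.ev_eq_zero one_ne_zero (hasShape_outPart hA) (hL.mono fun J hJ =>
      ⟨Or.inl hJ, Nat.one_le_iff_ne_zero.1 (hd.labels.1 J hJ), hd.labels.2.1 J hJ⟩)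
      (ev_eq_zero_of_map (hDR _ rfl) _ _)
  | next hd =>
    exact hd.ev_eq_zero one_ne_zero (hasShape_outPart hA) (hL.mono fun J hJ =>
      ⟨Or.inl (Or.inl (Or.inl hJ)), Nat.one_le_iff_ne_zero.1 (hd.labels.1 J hJ),
        hd.labels.2.1 J hJ⟩)
      (ev_eq_zero_of_map (hDR _ (Or.inl rfl)) _ _)

/-! ### The three sets of the MM-algorithm -/

section
variable {F : DEPoly ℝ} {out : FLFOutput} {Φ K : ℝ[X]} {z : ℕ → ℝ}

theorem coeff_zero_map_C (hF : F.coeff 0 = 0) :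
    (MvPolynomial.map (MvPolynomial.C : ℝ →+* Coef) F).coeff 0 = 0 := by
  rw [MvPolynomial.coeff_map, hF, map_zero]

/-- With zero input, the system reduces to its pure `δ`-part. -/
theorem ev_zero_input (ρ : Rule) (z : ℕ → ℝ) (A : DEPoly Coef) :
    ev ρ z 0 A = ev ρ z 0 (outPart A) := by
  rw [ev, outPart, MvPolynomial.eval₂Hom_bind₁]
  congr 2
  funext x
  rcases x with i | j <;> simp

theorem eval_eq_zero_of_mem_F1 (hF : F.coeff 0 = 0) (hout : FLF F out) (hΦ : Φ ∈ out.F1)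
    (hK : K ∣ Φ) (hz : seqAct K z = 0) (Q : ℝ[X]) :
    MvPolynomial.eval (Sum.elim z (seqAct (Q * K) z)) F = 0 := by
  obtain ⟨ρ, hρ, hc⟩ := hΦ
  rw [seqAct_mul, hz, map_zero, ← ev_map_C ρ, ev_zero_input]
  exact FLFLoop.ev_outPart_eq_zero hout (coeff_zero_map_C hF) 0 hρ.2
    (hc.kills (seqAct_eq_zero_of_dvd hz hK))

theorem seqAct_comm (p q : ℝ[X]) (z : ℕ → ℝ) : seqAct p (seqAct q z) = seqAct q (seqAct p z) := by
  rw [← seqAct_mul, mul_comm, seqAct_mul]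

theorem eval_eq_zero_of_mem_F2 (hF : F.coeff 0 = 0) (hout : FLF F out) (hΦ : Φ ∈ out.F2)
    (hK : K ∣ Φ) (hz : seqAct K z = 0) (S : ℝ[X]) :
    MvPolynomial.eval (Sum.elim z (seqAct S z)) F = 0 := by
  have hz' := seqAct_eq_zero_of_dvd hz hK
  have hv' : seqAct Φ (seqAct S z) = 0 := by rw [seqAct_comm, hz', map_zero]
  rcases hΦ with ⟨ρ, hρ, hc⟩ | ⟨ρ, hρ, hc⟩
  · have hL := (hc.kills hz').mono Set.subset_union_left
    rw [← ev_map_C ρ]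
    exact FLFLoop.ev_eq_zero hout (coeff_zero_map_C hF) hρ.1 (hL.mono (Set.sep_subset _ _))
      ((hc.kills hv').mono Set.subset_union_right) (Or.inl hL)
  · have hM := (hc.kills hv').mono Set.subset_union_right
    rw [← ev_map_C ρ]
    exact FLFLoop.ev_eq_zero hout (coeff_zero_map_C hF) hρ.1
      ((hc.kills hz').mono Set.subset_union_left) (hM.mono (Set.sep_subset _ _)) (Or.inr hM)

theorem ev_linear_map_C (ρ : Rule) (z v : ℕ → ℝ) (F : DEPoly ℝ) :
    ev ρ z v (MvPolynomial.homogeneousComponent 1 (MvPolynomial.map MvPolynomial.C F)) =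
      seqAct (outLinPart F) z 0 + seqAct (inLinPart F) v 0 := by
  classical
  have h : MvPolynomial.homogeneousComponent 1 (MvPolynomial.map MvPolynomial.C F) =
      MvPolynomial.map (MvPolynomial.C : ℝ →+* Coef) (MvPolynomial.homogeneousComponent 1 F) := by
    ext1 m
    simp only [MvPolynomial.coeff_homogeneousComponent, MvPolynomial.coeff_map]
    split_ifs <;> simp
  have h1 := eval₂_eq_of_isHomogeneous_one (RingHom.id ℝ) z v
    (MvPolynomial.homogeneousComponent_isHomogeneous 1 F)
  rw [Polynomial.map_id, Polynomial.map_id] at h1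
  rw [h, ev_map_C]
  exact h1

theorem eval_eq_zero_of_mem_F3 (hF : F.coeff 0 = 0) (hout : FLF F out) (hΦ : Φ ∈ out.F3)
    (hK : K ∣ Φ) (hz : seqAct K z = 0) {B R₀ Z₀ : ℝ[X]} (hB : inLinPart F = -B)
    (hRZ : R₀ * K + Z₀ * B = outLinPart F) (Q : ℝ[X]) :
    MvPolynomial.eval (Sum.elim z (seqAct (Z₀ + Q * K) z)) F = 0 := by
  have hz' := seqAct_eq_zero_of_dvd hz hK
  set v := seqAct (Z₀ + Q * K) z with hv
  have hv' : seqAct Φ v = 0 := by rw [hv, seqAct_comm, hz', map_zero]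
  -- On sequences killed by `K`, `A z - B (Z₀ + Q K) z = (A - Z₀ B) z = R₀ K z = 0`.
  have hlin : ∀ ρ : Rule, ev ρ z v
      (MvPolynomial.homogeneousComponent 1 (MvPolynomial.map MvPolynomial.C F)) = 0 := by
    intro ρ
    have h1 : seqAct (outLinPart F + inLinPart F * (Z₀ + Q * K)) z = 0 :=
      seqAct_eq_zero_of_dvd hz ⟨R₀ - B * Q, by rw [hB, ← hRZ]; ring⟩
    rw [seqAct_add, LinearMap.add_apply, seqAct_mul] at h1
    rw [ev_linear_map_C]
    exact congr_fun h1 0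
  rcases hΦ with ⟨ρ, hρ, hc⟩ | ⟨ρ, hρ, hc⟩
  · have hL := (hc.kills hz').mono Set.subset_union_left
    rw [← ev_map_C ρ, ← hlin ρ]
    exact FLFLoop.ev_eq_linear hout (coeff_zero_map_C hF) hρ.1
      (hL.mono fun J hJ => ⟨hJ.1.1, hJ.2⟩)
      ((hc.kills hv').mono Set.subset_union_right) (Or.inl hL)
  · have hM := (hc.kills hv').mono Set.subset_union_right
    rw [← ev_map_C ρ, ← hlin ρ]
    exact FLFLoop.ev_eq_linear hout (coeff_zero_map_C hF) hρ.1
      ((hc.kills hz').mono Set.subset_union_left)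
      (hM.mono fun J hJ => ⟨hJ.1.1, hJ.2⟩) (Or.inr hM)

end

end ModelMatching

open ModelMatching in
theorem theorem5p2 (F : DEPoly ℝ) (hF : F.coeff 0 = 0) (A B Ad : ℝ[X])
    (hA : outLinPart F = A) (hB : inLinPart F = -B)
    (out : FLFOutput) (hout : FLF F out) :
    (∀ Q : ℝ[X],
      (Ad ∈ out.F1 → Matches F (Q * Ad) Ad) ∧
      (Ad ∈ out.F2 → Matches F Q Ad) ∧
      (Ad ∈ out.F3 → ∀ R₀ Z₀ : ℝ[X], R₀ * Ad + Z₀ * B = A →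
        Matches F (Z₀ + Q * Ad) Ad)) ∧
    (Ad.coeff 0 ≠ 0 → ∀ Φ Φt : ℝ[X], IsGcd Φt Ad Φ → ¬ IsUnit Φt → ∀ Q : ℝ[X],
      (Φ ∈ out.F1 → MatchesRel F (Q * Φt) Ad Φt) ∧
      (Φ ∈ out.F2 → MatchesRel F Q Ad Φt) ∧
      (Φ ∈ out.F3 → ∀ R₀ Z₀ : ℝ[X], R₀ * Φt + Z₀ * B = A →
        MatchesRel F (Z₀ + Q * Φt) Ad Φt)) := by
  subst hA
  refine ⟨fun Q => ⟨fun h => ?_, fun h => ?_, fun h R₀ Z₀ hRZ => ?_⟩,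
    fun h0 Φ Φt hg _ Q => ⟨fun h => ?_, fun h => ?_, fun h R₀ Z₀ hRZ => ?_⟩⟩
  · exact matches_of_kills fun z hz => eval_eq_zero_of_mem_F1 hF hout h dvd_rfl hz Q
  · exact matches_of_kills fun z hz => eval_eq_zero_of_mem_F2 hF hout h dvd_rfl hz Q
  · exact matches_of_kills fun z hz => eval_eq_zero_of_mem_F3 hF hout h dvd_rfl hz hB hRZ Q
  · exact matchesRel_of_kills h0 hg.1 fun z hz => eval_eq_zero_of_mem_F1 hF hout h hg.2.1 hz Q
  · exact matchesRel_of_kills h0 hg.1 fun z hz => eval_eq_zero_of_mem_F2 hF hout h hg.2.1 hz Q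
  · exact matchesRel_of_kills h0 hg.1 fun z hz =>
      eval_eq_zero_of_mem_F3 hF hout h hg.2.1 hz hB hRZ Q
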